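/- Conventions. For elements of a group, $[x,y]=xyx^{-1}y^{-1}$ and $[x_1,\dots,x_k]=[x_1,[x_2,\dots,x_k]]$ for $k\ge 3$. For a group $\Gamma$, $\Gamma^{[1]}=\Gamma$ and $\Gamma^{[k+1]}=[\Gamma,\Gamma^{[k]}]$ for $k\ge 1$. $\operatorname{Out}(H)=\operatorname{Aut}(H)/\operatorname{Inn}(H)$. Theorem. Let $G=\{g_1,\dots,g_n\}$ be a finite group of order $n\ge 3$, let $p>n$ be a prime, and let $\zeta$ be a generator of $\mathbb{F}_p^\times$. Let $F$ be the free group on generators $x_g$ $(g\in G)$, let $F^p$ be the normal closure of all $p$-th powers in $F$, and put $\overline{F}=F/F^p$. Let $$N=\big\langle [x_{hg_1},\dots,x_{hg_{n-1}},x_{hg_1}] : h\in G\big\rangle\,\overline{F}^{[n+1]}\trianglelefteq\overline{F},\qquad P=\overline{F}/N .$$ Then for each $i\in G$ there is a unique automorphism $q_i$ of $P$ with $q_i(x_i)=x_i^{\zeta}$ and $q_i(x_j)=x_j$ for $j\ne i$. The subgroup $Q=\langle q_i : i\in G\rangle\le\operatorname{Aut}(P)$ is isomorphic to $C_{p-1}^n$.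 The semidirect product $H=P\rtimes Q$ (with the natural action of $Q$ on $P$) is finite, and $$\operatorname{Out}(H)\cong G.$$ Consequently, every finite group (of any order) is isomorphic to the outer automorphism group of some finite group. -/

import Mathlib

universe u

namespace FiniteOut

open scoped commutatorElement

/-- The group `Inn(H)` of inner automorphisms `x ↦ g * x * g⁻¹`, as a subgroup of `Aut(H)`. -/
abbrev Inn (H : Type*) [Group H] : Subgroup (MulAut H) := (MulAut.conj : H →* MulAut H).range

instance Inn.normal (H : Type*) [Group H] : (Inn H).Normal := by
  refine ⟨?_⟩
  rintro _ ⟨g, rfl⟩ a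
  refine ⟨a g, ?_⟩
  ext x
  simp [MulAut.mul_apply, MulAut.conj_apply]

/-- The outer automorphism group `Out(H) = Aut(H) / Inn(H)`. -/
abbrev Out (H : Type*) [Group H] : Type _ := MulAut H ⧸ Inn H

/-- Right-normed iterated commutators: `[a] = a`, `[a₁, …, aₖ] = [a₁, [a₂, …, aₖ]]`, where
`[x, y] = x y x⁻¹ y⁻¹`. -/
def iterComm {Γ : Type*} [Group Γ] : List Γ → Γ
  | [] => 1
  | [a] => a
  | a :: b :: l => ⁅a, iterComm (b :: l)⁆

/-- The normal closure `F^p` of all `p`-th powers in the free group `F` on the set `X`. -/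
def powerSubgroup (p : ℕ) (X : Type u) : Subgroup (FreeGroup X) :=
  Subgroup.normalClosure (Set.range fun w : FreeGroup X => w ^ p)

instance powerSubgroup.normal (p : ℕ) (X : Type u) : (powerSubgroup p X).Normal :=
  Subgroup.normalClosure_normal

/-- The free group of exponent `p` on the set `X`: the quotient `F / F^p` of the free group. -/
abbrev FreeExp (p : ℕ) (X : Type u) : Type u := FreeGroup X ⧸ powerSubgroup p X

/-- The free generators of `FreeExp p X`. -/
def FreeExp.gen (p : ℕ) {X : Type u} (i : X) : FreeExp p X :=
  QuotientGroup.mk (FreeGroup.of i)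

/-- The lower central series, numbered from `1` as usual in group theory: `gammaTerm Γ 1 = Γ` and
`gammaTerm Γ (k + 1) = [Γ, gammaTerm Γ k]` for `k ≥ 1`. Mathlib numbers it from `0`. -/
abbrev gammaTerm (Γ : Type u) [Group Γ] (k : ℕ) : Subgroup Γ :=
  (⊤ : Subgroup Γ).lowerCentralSeries (k - 1)

variable {G : Type u} [Group G]

/-- For an enumeration `g₁, …, gₙ` of `G` (here `e 0, …, e (n - 1)`) and `h ∈ G`, the `n`-fold
commutator `[x_{h g₁}, …, x_{h gₙ₋₁}, x_{h g₁}]` in the free group of exponent `p` on the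
generators `x_g`, `g ∈ G`. -/
def relator (p : ℕ) {n : ℕ} (e : Fin n ≃ G) (h : G) : FreeExp p G :=
  iterComm (List.ofFn fun i : Fin n =>
    FreeExp.gen p (h * e (if i.val + 1 < n then i else ⟨0, i.pos⟩)))

/-- The subgroup `N` generated by the commutators `[x_{h g₁}, …, x_{h gₙ₋₁}, x_{h g₁}]`, `h ∈ G`,
and the `(n + 1)`-st term of the lower central series. -/
def relSubgroup (p : ℕ) {n : ℕ} (e : Fin n ≃ G) : Subgroup (FreeExp p G) :=
  Subgroup.closure (Set.range (relator p e)) ⊔ gammaTerm (FreeExp p G) (n + 1)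

theorem iterComm_mem {Γ : Type u} [Group Γ] (l : List Γ) :
    iterComm l ∈ gammaTerm Γ l.length := by
  induction l with
  | nil => simp [iterComm]
  | cons a l ih =>
    cases l with
    | nil => exact Subgroup.mem_top a
    | cons b l =>
      have h2 : ⁅iterComm (b :: l), a⁆⁻¹ ∈ gammaTerm Γ (a :: b :: l).length :=
        inv_mem (Subgroup.commutator_mem_commutator ih (Subgroup.mem_top a))
      rwa [commutatorElement_inv] at h2

instance relSubgroup.normal (p : ℕ) {n : ℕ} (e : Fin n ≃ G) : (relSubgroup p e).Normal := by
  have hn : 0 < n := (e.symm 1).pos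
  obtain ⟨m, rfl⟩ : ∃ m, n = m + 1 := ⟨n - 1, by omega⟩
  have hle : relSubgroup p e ≤ gammaTerm (FreeExp p G) (m + 1) := by
    refine sup_le ?_ (Subgroup.lowerCentralSeries_antitone _ (by simp))
    rw [Subgroup.closure_le]
    rintro _ ⟨h, rfl⟩
    have := iterComm_mem (List.ofFn fun i : Fin (m + 1) =>
      FreeExp.gen p (h * e (if i.val + 1 < m + 1 then i else ⟨0, i.pos⟩)))
    rwa [List.length_ofFn] at this
  rw [← Subgroup.commutator_top_right_le_iff]
  exact (Subgroup.commutator_mono hle le_rfl).trans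
    (le_sup_right (a := Subgroup.closure (Set.range (relator p e))))

/-- The group `P`: the free group of exponent `p` on the generators `x_g`, `g ∈ G`, modulo `N`. It
is the quotient of the free group of exponent `p` and class `n` by the commutators
`[x_{h g₁}, …, x_{h gₙ₋₁}, x_{h g₁}]`, `h ∈ G`. -/
abbrev GroupP (p : ℕ) {n : ℕ} (e : Fin n ≃ G) : Type u := FreeExp p G ⧸ relSubgroup p e

/-- The image of the generator `x_g` in `P`. -/
def GroupP.gen (p : ℕ) {n : ℕ} (e : Fin n ≃ G) (g : G) : GroupP p e :=
  QuotientGroup.mk (FreeExp.gen p g)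

/-- The automorphism `q` of `P` is the `i`-th diagonal automorphism `q_i`: it sends `x_i` to
`x_i ^ ζ` and fixes `x_j` for `j ≠ i`. Since `P` has exponent `p`, the exponent `ζ`
is meaningful modulo `p`; there is at most one such `q`, because the `x_j` generate `P`. -/
def IsDiagAut {p n : ℕ} (e : Fin n ≃ G) (ζ : (ZMod p)ˣ) (i : G) (q : MulAut (GroupP p e)) : Prop :=
  q (GroupP.gen p e i) = GroupP.gen p e i ^ (ζ : ZMod p).val ∧
    ∀ j, j ≠ i → q (GroupP.gen p e j) = GroupP.gen p e j

/-- The subgroup `Q` of `Aut(P)` generated by the automorphisms `q_i`, `i ∈ G`. -/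
def groupQ {p n : ℕ} (e : Fin n ≃ G) (ζ : (ZMod p)ˣ) : Subgroup (MulAut (GroupP p e)) :=
  Subgroup.closure {q | ∃ i : G, IsDiagAut e ζ i q}

/-- The semidirect product `H = P ⋊ Q`, where `Q ≤ Aut(P)` acts on `P` in the natural way. -/
abbrev GroupH {p n : ℕ} (e : Fin n ≃ G) (ζ : (ZMod p)ˣ) : Type u :=
  GroupP p e ⋊[(groupQ e ζ).subtype] (groupQ e ζ)

end FiniteOut

/-! Let T be the group of diagonal automorphisms x_g ↦ x_g^{z_g} of P, with z_g in F_p^×. They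
preserve the relations because commutators of weight n are multiplicative in the exponents modulo
the next term of the lower central series, and Q = T because ζ generates F_p^× (`groupQ_eq_range`).
Left translation of indices permutes the relators, so G acts on P as well and normalizes T.

An automorphism of H preserves P, since P has exponent p and |T| is prime to p. Crossed
homomorphisms T → P are principal (`crossedHom_principal`), so after an inner correction the
automorphism also preserves T, and then it comes from the normalizer of T in Aut(P)
(`exists_conj_mul_eq_normalizerAut`). Exponent sums show that a normalizing β permutes the
coordinates of T. The elements of P fixed by every z in T with z_k = 1 are the powers of x_k
(`mem_zpowers_of_fixed`), so β permutes the generators up to powers. Up to T, it is a permutation σ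
of the generators.

The crux is that σ must be a left translation (`exists_eq_mul_of_relator_mem`). Mapping generators
to unitriangular matrices attached to a word makes the corner entry of a weight n commutator the
coefficient of that word in a Lie bracket. For a suitable word built from σ, this coefficient is
nonzero on the σ-image of a relator, but vanishes on all relators unless σ is a translation
(`coef_detectWord`). Hence the normalizer is T·G; T acts by inner automorphisms of H, so G maps onto
Out(H), and exponent sums show that the map is injective (`outHom_injective`). Groups of order 1 and
2 are treated separately. -/

namespace FiniteOut

open scoped commutatorElement
open scoped IsMulCommutative
open Subgroup (center)

/-! ### Commutator calculus and the lower central series -/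

section Commutators

variable {Γ : Type*} [Group Γ]

theorem commutator_pow_right {x y : Γ} (h : ⁅x, y⁆ ∈ center Γ) (b : ℕ) :
    ⁅x, y ^ b⁆ = ⁅x, y⁆ ^ b := by
  have h1 : x * y * x⁻¹ = ⁅x, y⁆ * y := by simp [commutatorElement_def]
  have h2 : Commute ⁅x, y⁆ y := (Subgroup.mem_center_iff.1 h y).symm
  rw [commutatorElement_def, ← conj_pow, h1, h2.mul_pow, mul_inv_cancel_right]

theorem commutator_pow_left {x y : Γ} (h : ⁅x, y⁆ ∈ center Γ) (a : ℕ) :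
    ⁅x ^ a, y⁆ = ⁅x, y⁆ ^ a := by
  rw [← commutatorElement_inv, commutator_pow_right, ← inv_pow, commutatorElement_inv]
  rw [← commutatorElement_inv]
  exact inv_mem h

theorem commutator_mul_center_right (x y : Γ) {c : Γ} (h : c ∈ center Γ) :
    ⁅x, y * c⁆ = ⁅x, y⁆ := by
  have h2 : x⁻¹ * c = c * x⁻¹ := Subgroup.mem_center_iff.1 h x⁻¹
  calc ⁅x, y * c⁆ = x * y * (c * x⁻¹) * c⁻¹ * y⁻¹ := by simp [commutatorElement_def, mul_assoc]
    _ = ⁅x, y⁆ := by rw [← h2]; simp [commutatorElement_def, mul_assoc]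

theorem mk_mem_center {N : Subgroup Γ} [N.Normal] {y : Γ} (h : ∀ x, ⁅y, x⁆ ∈ N) :
    (y : Γ ⧸ N) ∈ center (Γ ⧸ N) := by
  rw [Subgroup.mem_center_iff]
  intro g
  obtain ⟨x, rfl⟩ := QuotientGroup.mk_surjective g
  have h2 : ((⁅y, x⁆ : Γ) : Γ ⧸ N) = 1 := (QuotientGroup.eq_one_iff _).2 (h x)
  have h3 : ⁅(y : Γ ⧸ N), (x : Γ ⧸ N)⁆ = 1 := h2
  exact (commutatorElement_eq_one_iff_mul_comm.1 h3).symm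

theorem mk_mem_center_of_mem_lowerCentralSeries {k : ℕ} {y : Γ}
    (h : y ∈ (⊤ : Subgroup Γ).lowerCentralSeries k) :
    (y : Γ ⧸ (⊤ : Subgroup Γ).lowerCentralSeries (k + 1)) ∈ center _ :=
  mk_mem_center fun _ => Subgroup.commutator_mem_commutator h (Subgroup.mem_top _)

theorem commutator_mem_lowerCentralSeries (x : Γ) {k : ℕ} {y : Γ}
    (h : y ∈ (⊤ : Subgroup Γ).lowerCentralSeries k) :
    ⁅x, y⁆ ∈ (⊤ : Subgroup Γ).lowerCentralSeries (k + 1) := by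
  rw [← commutatorElement_inv]
  exact inv_mem (Subgroup.commutator_mem_commutator h (Subgroup.mem_top _))

theorem map_iterComm {Δ : Type*} [Group Δ] (f : Γ →* Δ) (l : List Γ) :
    f (iterComm l) = iterComm (l.map f) := by
  induction l with
  | nil => simp [iterComm]
  | cons a l ih =>
    cases l with
    | nil => simp [iterComm]
    | cons b l =>
      simp only [iterComm, List.map_cons, map_commutatorElement] at ih ⊢
      rw [ih]

theorem iterComm_cons (a : Γ) {l : List Γ} (h : l ≠ []) : iterComm (a :: l) = ⁅a, iterComm l⁆ := by
  cases l with
  | nil => exact absurd rfl h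
  | cons b l => rfl

theorem iterComm_mem_lowerCentralSeries (a : Γ) (l : List Γ) :
    iterComm (a :: l) ∈ (⊤ : Subgroup Γ).lowerCentralSeries l.length := by
  induction l generalizing a with
  | nil => exact Subgroup.mem_top a
  | cons b l ih => exact commutator_mem_lowerCentralSeries a (ih b)

/-- Modulo the next term of the lower central series, iterated commutators are multiplicative in
the exponents of their entries. -/
theorem mk_iterComm_map_pow {α : Type*} (f : α → Γ) (m : α → ℕ) (l : List α) :
    ((iterComm (l.map fun a => f a ^ m a) : Γ) : Γ ⧸ (⊤ : Subgroup Γ).lowerCentralSeries l.length) =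
      ((iterComm (l.map f) : Γ) : Γ ⧸ (⊤ : Subgroup Γ).lowerCentralSeries l.length) ^
        (l.map m).prod := by
  induction l with
  | nil => exact (one_pow 1).symm
  | cons a l ih =>
    cases l with
    | nil => simp [iterComm]; rfl
    | cons b l =>
      set y := iterComm ((b :: l).map fun a => f a ^ m a)
      set y₀ := iterComm ((b :: l).map f) with hy₀
      set M := ((b :: l).map m).prod with hM
      have h0 : y₀ ∈ (⊤ : Subgroup Γ).lowerCentralSeries l.length := by
        have := iterComm_mem_lowerCentralSeries (f b) (l.map f)
        rwa [List.length_map] at this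
      have hc := mk_mem_center_of_mem_lowerCentralSeries
        (commutator_mem_lowerCentralSeries (f a) h0)
      -- Only y ≡ y₀^M is known at this level. The discrepancy becomes central one level further
      -- down, so it disappears inside the commutator.
      have ht : (y₀ ^ M)⁻¹ * y ∈ (⊤ : Subgroup Γ).lowerCentralSeries (b :: l).length := by
        rw [← QuotientGroup.eq, ih]; rfl
      have hy : y = y₀ ^ M * ((y₀ ^ M)⁻¹ * y) := by group
      rw [List.map_cons (f := m), List.prod_cons]
      change ((⁅f a ^ m a, y⁆ : Γ) : Γ ⧸ (⊤ : Subgroup Γ).lowerCentralSeries (l.length + 1 + 1)) =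
        ((⁅f a, y₀⁆ : Γ) : Γ ⧸ (⊤ : Subgroup Γ).lowerCentralSeries (l.length + 1 + 1)) ^ (m a * M)
      rw [hy]
      let π := QuotientGroup.mk' ((⊤ : Subgroup Γ).lowerCentralSeries (l.length + 1 + 1))
      change π ⁅f a, y₀⁆ ∈ center _ at hc
      change π ⁅f a ^ m a, y₀ ^ M * ((y₀ ^ M)⁻¹ * y)⁆ = π ⁅f a, y₀⁆ ^ (m a * M)
      have ht' : π ((y₀ ^ M)⁻¹ * y) ∈ center _ := mk_mem_center_of_mem_lowerCentralSeries ht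
      rw [map_commutatorElement] at hc
      rw [map_commutatorElement, map_mul, map_pow, map_pow, map_commutatorElement,
        commutator_mul_center_right _ _ ht', mul_comm (m a), pow_mul, ← commutator_pow_right hc,
        commutator_pow_left]
      rw [commutator_pow_right hc]
      exact pow_mem hc _

/-- The terms of the lower central series are generated, modulo the next term, by iterated
commutators of generators. -/
theorem lowerCentralSeries_eq_closure_sup {α : Type*} {f : α → Γ}
    (hf : Subgroup.closure (Set.range f) = ⊤) (k : ℕ) :
    (⊤ : Subgroup Γ).lowerCentralSeries k =
      Subgroup.closure {y | ∃ l : List α, l.length = k + 1 ∧ y = iterComm (l.map f)} ⊔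
        (⊤ : Subgroup Γ).lowerCentralSeries (k + 1) := by
  have hle (k : ℕ) : Subgroup.closure {y | ∃ l : List α, l.length = k + 1 ∧
      y = iterComm (l.map f)} ≤ (⊤ : Subgroup Γ).lowerCentralSeries k := by
    rw [Subgroup.closure_le]
    rintro _ ⟨l, hl, rfl⟩
    obtain ⟨a, l, rfl⟩ := List.exists_cons_of_length_eq_add_one hl
    have := iterComm_mem_lowerCentralSeries (f a) (l.map f)
    simp only [List.length_map] at this
    simp only [List.length_cons, Nat.add_right_cancel_iff] at hl
    rwa [← hl]
  refine le_antisymm ?_ (sup_le (hle k) (Subgroup.lowerCentralSeries_antitone _ (Nat.le_succ k)))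
  induction k with
  | zero =>
    refine le_sup_of_le_left ?_
    rw [Subgroup.lowerCentralSeries_zero, ← hf]
    refine Subgroup.closure_mono ?_
    rintro _ ⟨a, rfl⟩
    exact ⟨[a], rfl, rfl⟩
  | succ k ih =>
    set D := Subgroup.closure {y | ∃ l : List α, l.length = k + 1 + 1 ∧ y = iterComm (l.map f)} ⊔
      (⊤ : Subgroup Γ).lowerCentralSeries (k + 1 + 1) with hD
    have hDle : D ≤ (⊤ : Subgroup Γ).lowerCentralSeries (k + 1) :=
      sup_le (hle (k + 1)) (Subgroup.lowerCentralSeries_antitone _ (Nat.le_succ _))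
    have hDn : D.Normal := by
      rw [← Subgroup.commutator_top_right_le_iff]
      exact (Subgroup.commutator_mono hDle le_rfl).trans le_sup_right
    have hgen : Subgroup.closure (Set.range fun a => (f a : Γ ⧸ D)) = ⊤ := by
      have : Set.range (fun a => (f a : Γ ⧸ D)) = QuotientGroup.mk' D '' Set.range f := by
        rw [← Set.range_comp]; rfl
      rw [this, ← MonoidHom.map_closure, hf, ← MonoidHom.range_eq_map, MonoidHom.range_eq_top]
      exact QuotientGroup.mk'_surjective D
    -- By the inductive hypothesis it suffices to treat commutators of k + 1 generators. Bracketing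
    -- with one more generator lands in D, so modulo D they commute with a generating set.
    have hcen : (⊤ : Subgroup Γ).lowerCentralSeries k ≤ (center (Γ ⧸ D)).comap
        (QuotientGroup.mk' D) := by
      refine ih.trans (sup_le ?_ ?_)
      · rw [Subgroup.closure_le]
        rintro _ ⟨l, hl, rfl⟩
        change ((iterComm (l.map f) : Γ) : Γ ⧸ D) ∈ center (Γ ⧸ D)
        have : (⊤ : Subgroup (Γ ⧸ D)) ≤ Subgroup.centralizer {((iterComm (l.map f) : Γ) : Γ ⧸ D)} := by
          rw [← hgen, Subgroup.closure_le]
          rintro _ ⟨a, rfl⟩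
          rw [SetLike.mem_coe, Subgroup.mem_centralizer_singleton_iff]
          rw [← commutatorElement_eq_one_iff_mul_comm]
          change ((⁅f a, iterComm (l.map f)⁆ : Γ) : Γ ⧸ D) = 1
          rw [QuotientGroup.eq_one_iff]
          refine Subgroup.mem_sup_left (Subgroup.subset_closure ⟨a :: l, by simp [hl], ?_⟩)
          rw [List.map_cons, iterComm_cons]
          intro h0
          rw [List.map_eq_nil_iff] at h0
          simp [h0] at hl
        rw [Subgroup.mem_center_iff]
        intro g
        exact Subgroup.mem_centralizer_singleton_iff.1 (this (Subgroup.mem_top g))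
      · intro y hy
        exact mk_mem_center fun x => Subgroup.mem_sup_right
          (Subgroup.commutator_mem_commutator hy (Subgroup.mem_top x))
    rw [Subgroup.lowerCentralSeries_succ, Subgroup.commutator_le]
    intro y hy x _
    rw [← QuotientGroup.eq_one_iff]
    change ⁅(y : Γ ⧸ D), (x : Γ ⧸ D)⁆ = 1
    rw [commutatorElement_eq_one_iff_mul_comm]
    exact (Subgroup.mem_center_iff.1 (hcen hy) x).symm

end Commutators

/-! ### Nilpotent groups of exponent p and coprime actions -/

/-- Induction through central quotients: if Γ/Z is finite, the centre Z has finite index and is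
therefore finitely generated; an abelian finitely generated torsion group is finite. -/
theorem finite_of_isNilpotent_of_fg (Γ : Type*) [Group Γ] [Group.IsNilpotent Γ] {p : ℕ}
    (hp : 0 < p) : Group.FG Γ → (∀ x : Γ, x ^ p = 1) → Finite Γ := by
  refine Group.nilpotent_center_quotient_ind
    (P := fun Γ _ _ => Group.FG Γ → (∀ x : Γ, x ^ p = 1) → Finite Γ) Γ ?_ ?_
  · intro Γ _ _ _ _
    infer_instance
  · intro Γ _ _ ih hfg hx
    have hq : Finite (Γ ⧸ center Γ) := by
      refine ih (Group.fg_of_surjective (QuotientGroup.mk'_surjective (center Γ))) fun y => ?_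
      obtain ⟨x, rfl⟩ := QuotientGroup.mk_surjective y
      rw [← QuotientGroup.mk_pow, hx]; rfl
    have hi : (center Γ).FiniteIndex := Subgroup.finiteIndex_of_finite_quotient
    have hc : Finite (center Γ) := by
      refine CommGroup.finite_of_fg_isMulTorsion (center Γ) fun y => ?_
      exact isOfFinOrder_iff_pow_eq_one.2 ⟨p, hp, Subtype.ext (hx y)⟩
    exact Finite.of_equiv _ (Subgroup.groupEquivQuotientProdSubgroup (s := center Γ)).symm

/-- The automorphisms induced on the quotient by a characteristic subgroup. -/
def quotientAut {Γ : Type*} [Group Γ] (N : Subgroup Γ) [N.Characteristic] :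
    MulAut Γ →* MulAut (Γ ⧸ N) where
  toFun φ := QuotientGroup.congr N N φ (Subgroup.characteristic_iff_map_eq.1 inferInstance φ)
  map_one' := by
    ext x
    obtain ⟨x, rfl⟩ := QuotientGroup.mk_surjective x
    rfl
  map_mul' φ ψ := by
    ext x
    obtain ⟨x, rfl⟩ := QuotientGroup.mk_surjective x
    rfl

theorem mem_of_pow_mem_of_coprime {Γ : Type*} [Group Γ] (B : Subgroup Γ) {y : Γ} {a p : ℕ}
    (hp : y ^ p = 1) (hc : a.Coprime p) (h : y ^ a ∈ B) : y ∈ B := by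
  have h1 : ((a.gcdA p : ℤ) * a + p * a.gcdB p : ℤ) = 1 := by
    have := Nat.gcd_eq_gcd_ab a p
    rw [hc] at this
    push_cast at this
    linarith
  have h2 : y = (y ^ a) ^ (a.gcdA p) := by
    conv_lhs => rw [← zpow_one y, ← h1, zpow_add, zpow_mul y (p : ℤ), zpow_natCast, hp, one_zpow,
      mul_one, mul_comm, zpow_mul, zpow_natCast]
  rw [h2]
  exact zpow_mem h _

/-- If a finite group `A` of order prime to `p` acts on `S`, and `y` is an `A`-fixed element in a
central subgroup of exponent `p` generated by fixed elements from `B` and by elements with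
nontrivial eigenvalues, then `y` belongs to `B`. -/
theorem mem_of_fixed {S A : Type*} [Group S] [Group A] [Finite A] {p : ℕ} (hp : p.Prime)
    (hA : (Nat.card A).Coprime p) (hS : ∀ x : S, x ^ p = 1) (φ : A →* MulAut S) {C : Set S}
    (hC : C ⊆ center S) (B : Subgroup S)
    (h : ∀ c ∈ C, (c ∈ B ∧ ∀ a, φ a c = c) ∨ ∃ (b : A) (k : ℕ), φ b c = c ^ k ∧ ¬ k ≡ 1 [MOD p])
    {y : S} (hy : y ∈ Subgroup.closure C) (hfix : ∀ a, φ a y = y) : y ∈ B := by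
  classical
  have := Fintype.ofFinite A
  -- The norm map of A. It is c ↦ c^|A| on fixed elements, and it kills an eigenvector with
  -- eigenvalue k ≢ 1, because E(c) = E(b·c) = E(c)^k.
  let E : center S →* center S := ∏ a : A, (Subgroup.centerCongr (φ a)).toMonoidHom
  have hE (c : center S) : E c = ∏ a : A, Subgroup.centerCongr (φ a) c := by
    simp [E, MonoidHom.finsetProd_apply]
  have hEfix (c : center S) (hc : ∀ a, φ a c = c) : E c = c ^ Nat.card A := by
    have h1 (a : A) : Subgroup.centerCongr (φ a) c = c := Subtype.ext (hc a)
    simp [hE, h1]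
  have hinv (b : A) (c : center S) : E (Subgroup.centerCongr (φ b) c) = E c := by
    rw [hE, hE]
    refine Fintype.prod_equiv (Equiv.mulRight b) _ _ fun a => ?_
    refine Subtype.ext ?_
    change φ a (φ b c) = φ (a * b) c
    rw [map_mul]; rfl
  have key : Subgroup.closure C ≤ ((B.comap (center S).subtype).comap E).map (center S).subtype := by
    rw [Subgroup.closure_le]
    intro c hc
    refine ⟨⟨c, hC hc⟩, ?_, rfl⟩
    rcases h c hc with ⟨hcB, hcf⟩ | ⟨b, k, hb, hk⟩
    · change ((E ⟨c, hC hc⟩ : center S) : S) ∈ B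
      rw [hEfix _ hcf]
      exact pow_mem hcB _
    · change ((E ⟨c, hC hc⟩ : center S) : S) ∈ B
      set z := E ⟨c, hC hc⟩ with hz
      have h1 : z = z ^ k := by
        rw [hz, ← map_pow, ← hinv b]
        congr 1
        exact Subtype.ext hb
      have hz1 : orderOf z ∣ p := orderOf_dvd_of_pow_eq_one (Subtype.ext (hS z))
      rcases (Nat.dvd_prime hp).1 hz1 with h2 | h2
      · rw [orderOf_eq_one_iff.1 h2]
        exact one_mem B
      · refine absurd ?_ hk
        rw [← h2, ← pow_eq_pow_iff_modEq, ← h1, pow_one]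
  obtain ⟨c, hc, rfl⟩ := key hy
  refine mem_of_pow_mem_of_coprime B (hS _) hA ?_
  have h2 : ((E c : center S) : S) ∈ B := hc
  rwa [hEfix c hfix] at h2

/-- Crossed homomorphisms from a finite group of order prime to `p` to a nilpotent group of
exponent `p` are principal. -/
theorem crossedHom_principal (Γ : Type*) [Group Γ] [Group.IsNilpotent Γ] {A : Type*} [Group A]
    [Finite A] {p : ℕ} (hp : p.Prime) (hA : (Nat.card A).Coprime p) :
    (∀ x : Γ, x ^ p = 1) → ∀ (φ : A →* MulAut Γ) (c : A → Γ),
      (∀ a b, c (a * b) = c a * φ a (c b)) → ∃ u : Γ, ∀ a, c a = u * (φ a u)⁻¹ := by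
  refine Group.nilpotent_center_quotient_ind
    (P := fun Γ _ _ => (∀ x : Γ, x ^ p = 1) → ∀ (φ : A →* MulAut Γ) (c : A → Γ),
      (∀ a b, c (a * b) = c a * φ a (c b)) → ∃ u : Γ, ∀ a, c a = u * (φ a u)⁻¹) Γ ?_ ?_
  · intro Γ _ _ _ φ c _
    exact ⟨1, fun a => Subsingleton.elim _ _⟩
  · intro Γ _ _ ih hx φ c hc
    classical
    have := Fintype.ofFinite A
    obtain ⟨u, hu⟩ := ih (fun y => by
      obtain ⟨x, rfl⟩ := QuotientGroup.mk_surjective y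
      rw [← QuotientGroup.mk_pow, hx]; rfl) ((quotientAut (center Γ)).comp φ)
      (fun a => (c a : Γ ⧸ center Γ)) (fun a b => by rw [hc]; rfl)
    obtain ⟨u, rfl⟩ := QuotientGroup.mk_surjective u
    -- Correcting c by a lift of the solution modulo the centre leaves a crossed homomorphism d with
    -- central values.
    have hcen (a : A) : u⁻¹ * c a * φ a u ∈ center Γ := by
      have h1 : ((u * (φ a u)⁻¹ : Γ) : Γ ⧸ center Γ) = c a := (hu a).symm
      have h2 := QuotientGroup.eq.1 h1
      have h3 := (inferInstance : (center Γ).Normal).conj_mem _ h2 (φ a u)⁻¹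
      convert h3 using 1
      group
    let d (a : A) : center Γ := ⟨_, hcen a⟩
    have hd (a b : A) : d (a * b) = d a * Subgroup.centerCongr (φ a) (d b) := by
      refine Subtype.ext ?_
      change u⁻¹ * c (a * b) * φ (a * b) u = u⁻¹ * c a * φ a u * φ a (u⁻¹ * c b * φ b u)
      rw [hc, map_mul, map_mul, map_mul, map_inv, MulAut.mul_apply]
      group
    -- Multiplying the cocycle identity over all b gives w = d(a)^|A| · a(w). Raising it to an
    -- inverse m of |A| modulo p exhibits d as the coboundary of w^m.
    let w : center Γ := ∏ b : A, d b
    have hw (a : A) : w = d a ^ Nat.card A * Subgroup.centerCongr (φ a) w := by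
      have h1 : w = ∏ b : A, d (a * b) :=
        (Fintype.prod_equiv (Equiv.mulLeft a) _ _ fun b => rfl).symm
      conv_lhs => rw [h1]
      simp only [hd]
      rw [Finset.prod_mul_distrib, ← map_prod]
      simp [w]
    obtain ⟨m, hm⟩ : ∃ m, Nat.card A * m ≡ 1 [MOD p] := by
      refine ⟨((Nat.card A : ZMod p)⁻¹).val, ?_⟩
      have : NeZero p := ⟨hp.ne_zero⟩
      rw [← ZMod.natCast_eq_natCast_iff]
      rw [Nat.cast_mul, ZMod.natCast_zmod_val, ZMod.coe_mul_inv_eq_one _ hA, Nat.cast_one]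
    have hv (a : A) : w ^ m = d a * Subgroup.centerCongr (φ a) (w ^ m) := by
      have hda : d a ^ p = 1 := Subtype.ext (hx _)
      conv_lhs => rw [hw a]
      rw [mul_pow, ← pow_mul, map_pow]
      congr 1
      conv_rhs => rw [← pow_one (d a)]
      rw [pow_eq_pow_iff_modEq]
      exact Nat.ModEq.of_dvd (orderOf_dvd_of_pow_eq_one hda) hm
    refine ⟨u * (w ^ m : center Γ), fun a => ?_⟩
    have h1 := congrArg Subtype.val (hv a)
    change ((w ^ m : center Γ) : Γ) = u⁻¹ * c a * φ a u * φ a ((w ^ m : center Γ) : Γ) at h1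
    rw [map_mul]
    conv_rhs => enter [1, 2]; rw [h1]
    group

/-! ### The free group of exponent p -/

section Lift

variable {X : Type u} {K : Type*} [Group K] {p : ℕ}

/-- The universal property of the free group of exponent `p`. -/
def FreeExp.lift (hK : ∀ k : K, k ^ p = 1) (f : X → K) : FreeExp p X →* K :=
  QuotientGroup.lift (powerSubgroup p X) (FreeGroup.lift f) <| by
    refine Subgroup.normalClosure_le_normal ?_
    rintro _ ⟨w, rfl⟩
    change FreeGroup.lift f (w ^ p) = 1
    rw [map_pow, hK]

@[simp]
theorem FreeExp.lift_gen (hK : ∀ k : K, k ^ p = 1) (f : X → K) (i : X) :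
    FreeExp.lift hK f (FreeExp.gen p i) = f i := by
  change FreeGroup.lift f (FreeGroup.of i) = f i
  simp

theorem FreeExp.pow_eq_one (x : FreeExp p X) : x ^ p = 1 := by
  obtain ⟨w, rfl⟩ := QuotientGroup.mk_surjective x
  rw [← QuotientGroup.mk_pow, QuotientGroup.eq_one_iff]
  exact Subgroup.subset_normalClosure ⟨w, rfl⟩

theorem FreeExp.closure_range_gen :
    Subgroup.closure (Set.range (FreeExp.gen p : X → FreeExp p X)) = ⊤ := by
  have : Set.range (FreeExp.gen p : X → FreeExp p X) =
      QuotientGroup.mk' (powerSubgroup p X) '' Set.range FreeGroup.of := by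
    rw [← Set.range_comp]; rfl
  rw [this, ← MonoidHom.map_closure, FreeGroup.closure_range_of, ← MonoidHom.range_eq_map,
    MonoidHom.range_eq_top]
  exact QuotientGroup.mk'_surjective _

end Lift

/-! ### Unitriangular matrices in characteristic p -/

section Band

variable {n : ℕ} {F : Type*} [Ring F]

/-- Square matrices of size `n + 1` all of whose nonzero entries lie on or above the `k`-th
superdiagonal. -/
def band (n : ℕ) (F : Type*) [Ring F] (k : ℕ) :
    AddSubgroup (Matrix (Fin (n + 1)) (Fin (n + 1)) F) where
  carrier := {M | ∀ i j, j.val < i.val + k → M i j = 0}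
  zero_mem' := fun _ _ _ => rfl
  add_mem' := fun {M N} hM hN i j h => by simp [hM i j h, hN i j h]
  neg_mem' := fun {M} hM i j h => by simp [hM i j h]

theorem band_antitone {k l : ℕ} (h : k ≤ l) : band n F l ≤ band n F k :=
  fun _ hM i j hij => hM i j (by omega)

theorem eq_zero_of_mem_band {k : ℕ} (h : n < k) {M : Matrix (Fin (n + 1)) (Fin (n + 1)) F}
    (hM : M ∈ band n F k) : M = 0 := by
  ext i j
  exact hM i j (by omega)

theorem mul_mem_band {k l : ℕ} {M N : Matrix (Fin (n + 1)) (Fin (n + 1)) F}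
    (hM : M ∈ band n F k) (hN : N ∈ band n F l) : M * N ∈ band n F (k + l) := by
  intro i j hij
  rw [Matrix.mul_apply]
  refine Finset.sum_eq_zero fun m _ => ?_
  by_cases h : m.val < i.val + k
  · rw [hM i m h, zero_mul]
  · rw [hN m j (by omega), mul_zero]

theorem one_mem_band_zero : (1 : Matrix (Fin (n + 1)) (Fin (n + 1)) F) ∈ band n F 0 :=
  fun i j hij => Matrix.one_apply_ne (by rintro rfl; omega)

theorem pow_mem_band {M : Matrix (Fin (n + 1)) (Fin (n + 1)) F} (hM : M ∈ band n F 1) (m : ℕ) :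
    M ^ m ∈ band n F m := by
  induction m with
  | zero => exact one_mem_band_zero
  | succ m ih => exact pow_succ M m ▸ mul_mem_band ih hM

/-- Frobenius gives (1 + M)^p = 1 + M^p, and M^p = 0 once p exceeds n. This makes the unitriangular
group a legitimate target for the free group of exponent p. -/
theorem one_add_pow_eq_one {p : ℕ} [Fact p.Prime] [CharP F p] (hp : n < p)
    {M : Matrix (Fin (n + 1)) (Fin (n + 1)) F} (hM : M ∈ band n F 1) : (1 + M) ^ p = 1 := by
  rw [add_pow_char_of_commute p (Commute.one_left M), one_pow,
    eq_zero_of_mem_band hp (pow_mem_band hM p), add_zero]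

variable (F) in
/-- The `k`-th term of the lower central series of the unitriangular group. -/
def unitriangular (n : ℕ) (p : ℕ) [Fact p.Prime] [CharP F p] (hp : n < p) (k : ℕ) :
    Subgroup (Matrix (Fin (n + 1)) (Fin (n + 1)) F)ˣ :=
  let S : Submonoid (Matrix (Fin (n + 1)) (Fin (n + 1)) F)ˣ :=
    { carrier := {u | (u : Matrix (Fin (n + 1)) (Fin (n + 1)) F) - 1 ∈ band n F (k + 1)}
      one_mem' := by simp [zero_mem]
      mul_mem' := by
        intro u v hu hv
        have h : ((u * v : (Matrix (Fin (n + 1)) (Fin (n + 1)) F)ˣ) :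
          Matrix (Fin (n + 1)) (Fin (n + 1)) F) - 1 = (u.val - 1) * (v.val - 1) +
            (u.val - 1) + (v.val - 1) := by
          rw [Units.val_mul]; noncomm_ring
        change _ ∈ band n F (k + 1)
        rw [h]
        exact add_mem (add_mem (band_antitone (by omega) (mul_mem_band hu hv)) hu) hv }
  { S with
    -- Every element has exponent p, so inverses are positive powers and closure under products
    -- suffices.
    inv_mem' := by
      intro u hu
      have h : u ^ p = 1 := by
        ext1
        have := one_add_pow_eq_one (F := F) hp (band_antitone (k := 1) (by omega) hu)
        rwa [add_sub_cancel] at this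
      have h2 : u⁻¹ = u ^ (p - 1) := by
        rw [inv_eq_iff_mul_eq_one, mul_pow_sub_one (Fact.out : p.Prime).ne_zero, h]
      rw [h2]
      exact S.pow_mem hu _ }

variable {p : ℕ} [Fact p.Prime] [CharP F p] {hp : n < p}

theorem mem_unitriangular {k : ℕ} {u : (Matrix (Fin (n + 1)) (Fin (n + 1)) F)ˣ} :
    u ∈ unitriangular F n p hp k ↔ u.val - 1 ∈ band n F (k + 1) := Iff.rfl

theorem pow_eq_one_of_mem_unitriangular (u : unitriangular F n p hp 0) : u ^ p = 1 := by
  ext1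
  ext1
  have := one_add_pow_eq_one (F := F) hp u.2
  rwa [add_sub_cancel] at this

/-- Modulo higher terms, commutators of unitriangular matrices are given by the Lie bracket. -/
theorem commutator_sub_mem_band {k : ℕ} {u v : (Matrix (Fin (n + 1)) (Fin (n + 1)) F)ˣ}
    (hu : u ∈ unitriangular F n p hp 0) (hv : v ∈ unitriangular F n p hp k) :
    (⁅u, v⁆ : (Matrix (Fin (n + 1)) (Fin (n + 1)) F)ˣ).val - 1 -
      ((u.val - 1) * (v.val - 1) - (v.val - 1) * (u.val - 1)) ∈ band n F (k + 3) := by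
  set c := (u.val - 1) * (v.val - 1) - (v.val - 1) * (u.val - 1) with hc
  have hcm : c ∈ band n F (k + 2) :=
    sub_mem (band_antitone (by omega) (mul_mem_band hu hv))
      (band_antitone (by omega) (mul_mem_band hv hu))
  have hw : u⁻¹ * v⁻¹ ∈ unitriangular F n p hp 0 :=
    mul_mem (inv_mem hu) (inv_mem (band_antitone (by omega) hv))
  -- [u, v] − 1 = (uv − vu)u⁻¹v⁻¹; replacing u⁻¹v⁻¹ by 1 costs a term lying at least one
  -- superdiagonal higher.
  have h1 : (⁅u, v⁆ : (Matrix (Fin (n + 1)) (Fin (n + 1)) F)ˣ).val - 1 =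
      c * (u⁻¹ * v⁻¹ : (Matrix (Fin (n + 1)) (Fin (n + 1)) F)ˣ).val := by
    have h2 : c = u.val * v.val - v.val * u.val := by rw [hc]; noncomm_ring
    rw [h2, sub_mul, ← Units.val_mul, ← Units.val_mul, ← Units.val_mul, ← Units.val_mul,
      commutatorElement_def]
    congr 1
    · congr 1; group
    · exact Units.val_one.symm.trans (congrArg Units.val (by group))
  have h3 : c * (u⁻¹ * v⁻¹ : (Matrix (Fin (n + 1)) (Fin (n + 1)) F)ˣ).val - c =
      c * ((u⁻¹ * v⁻¹ : (Matrix (Fin (n + 1)) (Fin (n + 1)) F)ˣ).val - 1) := by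
    rw [mul_sub, mul_one]
  rw [h1, h3]
  exact band_antitone (by omega) (mul_mem_band hcm hw)

theorem commutator_mem_unitriangular {k : ℕ} {u v : (Matrix (Fin (n + 1)) (Fin (n + 1)) F)ˣ}
    (hu : u ∈ unitriangular F n p hp 0) (hv : v ∈ unitriangular F n p hp k) :
    ⁅u, v⁆ ∈ unitriangular F n p hp (k + 1) := by
  have h := add_mem (band_antitone (k := k + 2) (by omega) (commutator_sub_mem_band hu hv))
    (sub_mem (band_antitone (k := k + 2) (by omega) (mul_mem_band hu hv))
      (band_antitone (k := k + 2) (by omega) (mul_mem_band hv hu)))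
  rwa [sub_add_cancel] at h

theorem map_lowerCentralSeries_le_unitriangular {Γ : Type*} [Group Γ]
    (f : Γ →* unitriangular F n p hp 0) (k : ℕ) {x : Γ}
    (hx : x ∈ (⊤ : Subgroup Γ).lowerCentralSeries k) :
    (f x : (Matrix (Fin (n + 1)) (Fin (n + 1)) F)ˣ) ∈ unitriangular F n p hp k := by
  suffices h : (⊤ : Subgroup Γ).lowerCentralSeries k ≤ (unitriangular F n p hp k).comap
    ((unitriangular F n p hp 0).subtype.comp f) from h hx
  clear hx x
  induction k with
  | zero => exact fun x _ => (f x).2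
  | succ k ih =>
    rw [Subgroup.lowerCentralSeries_succ, Subgroup.commutator_le]
    intro y hy z _
    rw [Subgroup.mem_comap, ← commutatorElement_inv, map_inv, map_commutatorElement]
    exact inv_mem (commutator_mem_unitriangular (f z).2 (ih hy))

/-! ### The path representation of a word and coefficients of Lie brackets -/

variable {G : Type*} [DecidableEq G] (w : ℕ → G)

variable (n F) in
/-- The matrix representing the letter `g` in the path representation attached to the word `w`. -/
def letter (g : G) : Matrix (Fin (n + 1)) (Fin (n + 1)) F :=
  fun i j => if j.val = i.val + 1 ∧ w i = g then 1 else 0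

theorem letter_mem_band (g : G) : letter n F w g ∈ band n F 1 :=
  fun i j h => if_neg (by omega)

theorem letter_mul_apply (g : G) (M : Matrix (Fin (n + 1)) (Fin (n + 1)) F) {i j : Fin (n + 1)}
    {i' : Fin (n + 1)} (hi : i'.val = i.val + 1) :
    (letter n F w g * M) i j = if w i = g then M i' j else 0 := by
  rw [Matrix.mul_apply, Finset.sum_eq_single i']
  · simp [letter, hi]
  · intro m _ hm
    have : m.val ≠ i.val + 1 := fun h => hm (Fin.ext (by omega))
    simp [letter, this]
  · simp

theorem mul_letter_apply (g : G) (M : Matrix (Fin (n + 1)) (Fin (n + 1)) F) {i j : Fin (n + 1)}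
    {j' : Fin (n + 1)} (hj : j.val = j'.val + 1) :
    (M * letter n F w g) i j = if w j' = g then M i j' else 0 := by
  rw [Matrix.mul_apply, Finset.sum_eq_single j']
  · simp [letter, hj]
  · intro m _ hm
    have : j.val ≠ m.val + 1 := fun h => hm (Fin.ext (by omega))
    simp [letter, this]
  · simp

/-- The unit `1 + letter n F w g`. -/
def letterUnit (p : ℕ) [Fact p.Prime] [CharP F p] (hp : n < p) (g : G) :
    unitriangular F n p hp 0 :=
  ⟨Units.ofPowEqOne (1 + letter n F w g) p (one_add_pow_eq_one hp (letter_mem_band w g))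
    (Fact.out : p.Prime).ne_zero, by
    rw [mem_unitriangular, Units.val_ofPowEqOne, add_sub_cancel_left]
    exact letter_mem_band w g⟩

variable (n F) in
/-- The iterated Lie bracket of the letters of `l`. -/
def lieWord : List G → Matrix (Fin (n + 1)) (Fin (n + 1)) F
  | [] => 0
  | [a] => letter n F w a
  | a :: b :: l => letter n F w a * lieWord (b :: l) - lieWord (b :: l) * letter n F w a

variable (F) in
/-- The coefficient of `w i ⋯ w (i + l.length - 1)` in the iterated Lie bracket of the letters
of `l`. -/
def coef : List G → ℕ → F
  | [], _ => 0
  | [a], i => if w i = a then 1 else 0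
  | a :: b :: l, i => (if w i = a then coef (b :: l) (i + 1) else 0) -
      if w (i + (b :: l).length) = a then coef (b :: l) i else 0

theorem lieWord_mem_band (l : List G) : lieWord n F w l ∈ band n F l.length := by
  induction l with
  | nil => exact zero_mem _
  | cons a l ih =>
    cases l with
    | nil => exact letter_mem_band w a
    | cons b l =>
      exact sub_mem (band_antitone (by simp only [List.length_cons]; omega)
          (mul_mem_band (letter_mem_band w a) ih))
        (band_antitone (by simp) (mul_mem_band ih (letter_mem_band w a)))

theorem lieWord_apply {l : List G} (hl : l ≠ []) {i j : Fin (n + 1)}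
    (h : j.val = i.val + l.length) : lieWord n F w l i j = coef F w l i := by
  induction l generalizing i j with
  | nil => exact absurd rfl hl
  | cons a l ih =>
    cases l with
    | nil => simp [lieWord, letter, coef, h]
    | cons b l =>
      have hj : i.val + (b :: l).length + 1 = j.val := by rw [h, List.length_cons (a := a)]; omega
      have hjn := j.2
      rw [lieWord, coef, Matrix.sub_apply,
        letter_mul_apply w a _ (i' := ⟨i.val + 1, by omega⟩) rfl,
        mul_letter_apply w a _ (j' := ⟨i.val + (b :: l).length, by omega⟩) hj.symm,
        ih (by simp) (by simp only; omega), ih (by simp) rfl]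

theorem iterComm_letterUnit_sub_mem_band {l : List G} (hl : l ≠ []) :
    (iterComm (l.map (letterUnit (F := F) w p hp))).val.val
      - 1 - lieWord n F w l ∈ band n F (l.length + 1) := by
  induction l with
  | nil => exact absurd rfl hl
  | cons a l ih =>
    cases l with
    | nil =>
      simp [iterComm, lieWord, letterUnit, zero_mem]
    | cons b l =>
      specialize ih (by simp)
      set v := iterComm ((b :: l).map (letterUnit (F := F) w p hp)) with hv
      have hvm : (v : (Matrix (Fin (n + 1)) (Fin (n + 1)) F)ˣ) ∈
          unitriangular F n p hp l.length := by
        rw [mem_unitriangular]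
        have := add_mem (band_antitone (Nat.le_succ _) ih) (lieWord_mem_band w (b :: l))
        rwa [sub_add_cancel] at this
      have hu : (letterUnit (F := F) w p hp a : (Matrix (Fin (n + 1)) (Fin (n + 1)) F)ˣ).val - 1 =
          letter n F w a := by
        simp [letterUnit]
      have h1 := commutator_sub_mem_band (letterUnit (F := F) w p hp a).2 hvm
      rw [hu] at h1
      have h2 := sub_mem (band_antitone (k := l.length + 3) (by simp only [List.length_cons]; omega)
          (mul_mem_band (letter_mem_band w a) ih))
        (band_antitone (k := l.length + 3) (by simp) (mul_mem_band ih (letter_mem_band w a)))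
      have h3 := add_mem h1 h2
      change _ ∈ band n F (l.length + 3)
      convert h3 using 1
      change (⁅(letterUnit (F := F) w p hp a : (Matrix (Fin (n + 1)) (Fin (n + 1)) F)ˣ),
        (v : (Matrix (Fin (n + 1)) (Fin (n + 1)) F)ˣ)⁆).val - 1 -
          (letter n F w a * lieWord n F w (b :: l) - lieWord n F w (b :: l) * letter n F w a) = _
      noncomm_ring

/-- The path representation detects the coefficient of the word `w` in an iterated commutator. -/
theorem iterComm_letterUnit_eq_one_iff {l : List G} (hl : l.length = n) (hn : n ≠ 0) :
    iterComm (l.map (letterUnit (F := F) w p hp)) = 1 ↔ coef F w l 0 = 0 := by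
  have hl0 : l ≠ [] := by rintro rfl; exact hn hl.symm
  have h1 := eq_zero_of_mem_band (by omega)
    (iterComm_letterUnit_sub_mem_band (F := F) (hp := hp) w hl0)
  have h2 : lieWord n F w l 0 (Fin.last n) = coef F w l 0 :=
    lieWord_apply w hl0 (by simp [hl])
  rw [← h2]
  constructor
  · intro h
    rw [h] at h1
    simp only [OneMemClass.coe_one, Units.val_one, sub_self, zero_sub, neg_eq_zero] at h1
    rw [h1]; rfl
  · intro h
    have h3 : lieWord n F w l = 0 := by
      ext i j
      by_cases hij : j.val < i.val + n
      · exact lieWord_mem_band w l i j (by omega)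
      · have hi : i = 0 := Fin.ext (by rw [Fin.val_zero]; omega)
        have hj : j = Fin.last n := Fin.ext (by simp; omega)
        rw [hi, hj, h]; rfl
    rw [h3, sub_zero, sub_eq_zero] at h1
    exact Subtype.ext (Units.ext h1)

/-- Each bracket [a, L] = aL − La puts a at one end of the words of L, so only rearrangements of the
letters can occur. -/
theorem perm_of_coef_ne_zero {l : List G} {i : ℕ} (h : coef F w l i ≠ 0) :
    l.Perm ((List.range' i l.length).map w) := by
  induction l generalizing i with
  | nil => simp
  | cons a l ih =>
    cases l with
    | nil =>
      have : w i = a := by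
        by_contra h2
        simp [coef, h2] at h
      simp [this]
    | cons b l =>
      rw [coef] at h
      by_cases h1 : w i = a ∧ coef F w (b :: l) (i + 1) ≠ 0
      · have := ih h1.2
        rw [List.length_cons (a := a), List.range'_succ, List.map_cons, h1.1]
        exact this.cons a
      · have h2 : w (i + (b :: l).length) = a ∧ coef F w (b :: l) i ≠ 0 := by
          by_contra h3
          apply h
          split_ifs <;> simp_all
        have := ih h2.2
        rw [List.length_cons (a := a), List.range'_concat, List.map_append, List.map_singleton,
          mul_comm, mul_one, h2.1]
        exact (this.cons a).trans (List.perm_append_singleton a _).symm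

/-- Since w ends in x here and x is not in m, no letter of m may be placed on the right. Placing
each on the left is the only surviving choice, with sign +1. -/
theorem coef_concat {m : List G} {x : G} (hx : x ∉ m) {i : ℕ} (hi : w (i + m.length) = x) :
    coef F w (m ++ [x]) i = if m = (List.range' i m.length).map w then 1 else 0 := by
  induction m generalizing i with
  | nil => simpa [coef] using fun h => absurd hi h
  | cons a m ih =>
    have hx1 : x ≠ a := fun h => hx (by simp [h])
    have hx2 : x ∉ m := fun h => hx (by simp [h])
    have hi2 : w (i + 1 + m.length) = x := by
      rw [← hi, List.length_cons, add_assoc, add_comm 1]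
    obtain ⟨b, l, hbl⟩ : ∃ b l, m ++ [x] = b :: l := List.exists_cons_of_ne_nil (by simp)
    have hlen : (b :: l).length = (a :: m).length := by rw [← hbl]; simp
    rw [List.cons_append, hbl, coef, ← hbl, ih hx2 hi2, hbl, hlen, hi, if_neg hx1, sub_zero,
      List.length_cons, List.range'_succ, List.map_cons]
    by_cases h : w i = a
    · simp [h]
    · rw [if_neg h, if_neg fun h2 => h (List.cons.inj h2).1.symm]

end Band

/-! ### Rigidity of the relators -/

/-- The word `b₁ ⋯ bₘ b₀ b₀`. -/
def detectWord {G : Type*} {m : ℕ} (b : Fin (m + 2) → G) (i : ℕ) : G :=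
  if h : i < m then b ⟨i + 1, by omega⟩ else b 0

theorem ofFn_relator {G : Type*} {m : ℕ} (a : Fin (m + 2) → G) :
    (List.ofFn fun i : Fin (m + 2) => a (if i.val + 1 < m + 2 then i else 0)) =
      a 0 :: ((List.range' 0 m).map (detectWord a) ++ [a 0]) := by
  rw [List.ofFn_succ, List.ofFn_succ', List.concat_eq_append]
  congr 2
  · refine List.ext_getElem (by simp) fun i h1 h2 => ?_
    simp only [List.length_ofFn] at h1
    simp [detectWord, h1]
  · simp

/-- With L = [a₁, …, aₘ, a₀] the bracket is a₀L − La₀. The first product would need L to contain a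
word with b₀ repeated, impossible as the letters of L are distinct. The second contributes exactly
when b₀ = a₀ and b₁⋯bₘb₀ = a₁⋯aₘa₀. The last value of a never enters. -/
theorem coef_detectWord {G F : Type*} [DecidableEq G] [Ring F] [Nontrivial F] {m : ℕ} (hm : m ≠ 0)
    {a b : Fin (m + 2) → G} (ha : Function.Injective a) :
    coef F (detectWord b)
      (List.ofFn fun i : Fin (m + 2) => a (if i.val + 1 < m + 2 then i else 0)) 0 ≠ 0 ↔
      ∀ i : Fin (m + 2), i.val < m + 1 → a i = b i := by
  rw [ofFn_relator]
  set M := (List.range' 0 m).map (detectWord a) with hM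
  have hMl : M.length = m := by simp [hM]
  have ha0 : a 0 ∉ M := by
    rw [hM, List.mem_map]
    rintro ⟨i, hi, h⟩
    have him : i < m := by simpa using hi
    rw [detectWord, dif_pos him] at h
    simpa using ha h
  have hMn : (M ++ [a 0]).Nodup := by
    rw [← List.concat_eq_append, List.nodup_concat]
    refine ⟨ha0, ?_⟩
    rw [hM]
    refine List.Nodup.map_on ?_ List.nodup_range'
    intro i hi j hj h
    have him : i < m := by simpa using hi
    have hjm : j < m := by simpa using hj
    rw [detectWord, dif_pos him, detectWord, dif_pos hjm] at h
    simpa using ha h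
  -- Positions m and m + 1 of the word both carry b₀, and both lie in the window starting at 1
  -- because m ≠ 0; this is where n ≥ 3 matters.
  have hfirst : coef F (detectWord b) (M ++ [a 0]) 1 = 0 := by
    by_contra h
    have h1 := (perm_of_coef_ne_zero _ h).nodup_iff.1 hMn
    have h2 := List.inj_on_of_nodup_map h1 (x := m) (by simp [hMl]; omega) (y := m + 1)
      (by simp [hMl]) (by simp [detectWord])
    omega
  obtain ⟨c, l, hcl⟩ : ∃ c l, M ++ [a 0] = c :: l := List.exists_cons_of_ne_nil (by simp)
  have hlen : (c :: l).length = m + 1 := by rw [← hcl]; simp [hMl]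
  rw [hcl, coef, ← hcl, hfirst, hcl, hlen, ← hcl, ite_self, zero_sub, neg_ne_zero]
  have hlast : detectWord b (0 + (m + 1)) = b 0 := by simp [detectWord]
  rw [hlast]
  by_cases hab : b 0 = a 0
  · rw [if_pos hab, coef_concat _ ha0 (by simp [hMl, detectWord, hab]), hMl, hM]
    simp only [ne_eq, ite_eq_right_iff, one_ne_zero, imp_false, not_not]
    rw [List.map_inj_left]
    constructor
    · intro h i hi
      obtain ⟨i, hi2⟩ := i
      cases i with
      | zero => exact hab.symm
      | succ i =>
        have him : i < m := by simp at hi; omega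
        have := h i (by simpa using him)
        rwa [detectWord, dif_pos him, detectWord, dif_pos him] at this
    · intro h i hi
      have him : i < m := by simpa using hi
      rw [detectWord, dif_pos him, detectWord, dif_pos him]
      exact h _ (by simpa using him)
  · rw [if_neg hab]
    simp only [ne_eq, not_true_eq_false, false_iff, not_forall]
    exact ⟨0, by simp, fun h => hab h.symm⟩

/-- A permutation of the generators that preserves the relations is a left translation. -/
theorem exists_eq_mul_of_relator_mem {G : Type u} [Group G] {n p : ℕ} (hn : 3 ≤ n) (hp : p.Prime)
    (hnp : n < p) (e : Fin n ≃ G) (σ : Equiv.Perm G)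
    (hσ : iterComm (List.ofFn fun i : Fin n =>
      FreeExp.gen p (σ (e (if i.val + 1 < n then i else ⟨0, i.pos⟩)))) ∈ relSubgroup p e) :
    ∃ h : G, ∀ g, σ g = h * g := by
  classical
  obtain ⟨m, rfl⟩ : ∃ m, n = m + 2 := ⟨n - 2, by omega⟩
  have := Fact.mk hp
  let b : Fin (m + 2) → G := fun i => σ (e i)
  let f : FreeExp p G →* unitriangular (ZMod p) (m + 2) p hnp 0 :=
    FreeExp.lift pow_eq_one_of_mem_unitriangular (letterUnit (detectWord b) p hnp)
  have hf (a : Fin (m + 2) → G) : f (iterComm (List.ofFn fun i : Fin (m + 2) =>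
      FreeExp.gen p (a (if i.val + 1 < m + 2 then i else 0)))) = 1 ↔
        coef (ZMod p) (detectWord b)
          (List.ofFn fun i : Fin (m + 2) => a (if i.val + 1 < m + 2 then i else 0)) 0 = 0 := by
    rw [map_iterComm, ← iterComm_letterUnit_eq_one_iff (p := p) (hp := hnp) _ (by simp) (by simp),
      List.map_ofFn, List.map_ofFn]
    simp only [Function.comp_def, f, FreeExp.lift_gen]
  by_contra hcon
  -- If σ is no translation, the representation attached to b = σ ∘ e kills all of N, yet it detects
  -- the commutator formed from b itself.
  have hker : relSubgroup p e ≤ f.ker := by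
    refine sup_le ?_ ?_
    · rw [Subgroup.closure_le]
      rintro _ ⟨h, rfl⟩
      refine (hf fun i => h * e i).2 ?_
      by_contra h0
      have h1 := (coef_detectWord (by omega) ((mul_right_injective h).comp e.injective)).1 h0
      refine hcon ⟨h, fun g => ?_⟩
      obtain ⟨i, rfl⟩ := e.surjective g
      -- Agreement is known at all indices but the last; there it follows from bijectivity of σ and
      -- of translation by h.
      by_cases hi : i.val < m + 1
      · exact (h1 i hi).symm
      · obtain ⟨j, hj⟩ := (e.trans σ).surjective (h * e i)
        by_cases hj2 : j.val < m + 1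
        · have h2 : h * e j = σ (e j) := h1 j hj2
          have h3 : h * e j = h * e i := h2.trans hj
          rw [e.injective (mul_left_cancel h3)] at hj2
          exact absurd hj2 hi
        · have : i = j := Fin.ext (by omega)
          rw [this] at hj ⊢
          exact hj
    · intro x hx
      have h1 := map_lowerCentralSeries_le_unitriangular f _ hx
      rw [mem_unitriangular] at h1
      have h2 := eq_zero_of_mem_band (by omega) h1
      exact Subtype.ext (Units.ext (sub_eq_zero.1 h2))
  have h1 := (hf b).1 (hker hσ)
  exact (coef_detectWord (F := ZMod p) (by omega)
    (σ.injective.comp e.injective)).2 (fun i _ => rfl) h1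

theorem pow_val_mul {Γ : Type*} [Group Γ] {p : ℕ} [NeZero p] {x : Γ} (hx : x ^ p = 1)
    (a b : ZMod p) : x ^ (a * b).val = (x ^ a.val) ^ b.val := by
  rw [← pow_mul, pow_eq_pow_iff_modEq]
  refine Nat.ModEq.of_dvd (orderOf_dvd_of_pow_eq_one hx) ?_
  rw [ZMod.val_mul]
  exact Nat.mod_modEq _ _

theorem multiplicative_zmod_pow_eq_one {p : ℕ} (x : Multiplicative (ZMod p)) : x ^ p = 1 := by
  rw [← ofAdd_toAdd x, ← ofAdd_nsmul]
  simp

theorem iterComm_replicate {Γ : Type*} [Group Γ] (x : Γ) (m : ℕ) :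
    iterComm (List.replicate (m + 2) x) = 1 := by
  induction m with
  | zero => exact commutatorElement_self x
  | succ m ih =>
    rw [List.replicate_succ, iterComm_cons _ (by simp), ih, commutatorElement_one_right]

/-! ### The group P, its diagonal automorphisms and its translations -/

section GroupP

variable {G : Type u} [Group G] {p n : ℕ} (e : Fin n ≃ G)

namespace GroupP

variable {e} in
theorem pow_eq_one (x : GroupP p e) : x ^ p = 1 := by
  obtain ⟨w, rfl⟩ := QuotientGroup.mk_surjective x
  rw [← QuotientGroup.mk_pow, FreeExp.pow_eq_one]; rfl

theorem closure_range_gen : Subgroup.closure (Set.range (GroupP.gen p e)) = ⊤ := by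
  have : Set.range (GroupP.gen p e) =
      QuotientGroup.mk' (relSubgroup p e) '' Set.range (FreeExp.gen p) := by
    rw [← Set.range_comp]; rfl
  rw [this, ← MonoidHom.map_closure, FreeExp.closure_range_gen, ← MonoidHom.range_eq_map,
    MonoidHom.range_eq_top]
  exact QuotientGroup.mk'_surjective _

variable {e} in
theorem hom_ext {K : Type*} [Group K] {f f' : GroupP p e →* K}
    (h : ∀ g, f (gen p e g) = f' (gen p e g)) : f = f' :=
  MonoidHom.eq_of_eqOn_dense (closure_range_gen e) (by rintro _ ⟨g, rfl⟩; exact h g)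

variable {e} in
theorem aut_ext {f f' : MulAut (GroupP p e)} (h : ∀ g, f (gen p e g) = f' (gen p e g)) :
    f = f' :=
  MulEquiv.toMonoidHom_injective (hom_ext h)

theorem lowerCentralSeries_eq_bot : (⊤ : Subgroup (GroupP p e)).lowerCentralSeries n = ⊥ := by
  have h := Subgroup.map_lowerCentralSeries (⊤ : Subgroup (FreeExp p G))
    (QuotientGroup.mk' (relSubgroup p e)) n
  rw [← MonoidHom.range_eq_map, MonoidHom.range_eq_top.2 (QuotientGroup.mk'_surjective _)] at h
  rw [← h, eq_bot_iff, Subgroup.map_le_iff_le_comap]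
  intro x hx
  exact (QuotientGroup.eq_one_iff x).2 (Subgroup.mem_sup_right hx)

instance : Group.IsNilpotent (GroupP p e) :=
  Subgroup.nilpotent_iff_lowerCentralSeries.2 ⟨n, lowerCentralSeries_eq_bot e⟩

theorem finite [Finite G] (hp : 0 < p) : Finite (GroupP p e) := by
  refine finite_of_isNilpotent_of_fg _ hp ?_ pow_eq_one
  exact Group.fg_iff.2 ⟨_, closure_range_gen e, Set.finite_range _⟩

variable {e} in
/-- The endomorphism of `P` induced by a map on generators that preserves the relations. -/
def map (f : G → FreeExp p G)
    (hf : ∀ h, FreeExp.lift FreeExp.pow_eq_one f (relator p e h) ∈ relSubgroup p e) :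
    GroupP p e →* GroupP p e :=
  QuotientGroup.map _ _ (FreeExp.lift FreeExp.pow_eq_one f) <| by
    refine sup_le ?_ ?_
    · rw [Subgroup.closure_le]
      rintro _ ⟨h, rfl⟩
      exact hf h
    · rw [← Subgroup.map_le_iff_le_comap]
      exact (Subgroup.map_lowerCentralSeries _ _ _).le.trans
        ((Subgroup.lowerCentralSeries_mono _ le_top).trans le_sup_right)

variable {e} in
@[simp]
theorem map_gen (f : G → FreeExp p G)
    (hf : ∀ h, FreeExp.lift FreeExp.pow_eq_one f (relator p e h) ∈ relSubgroup p e) (g : G) :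
    map f hf (gen p e g) = (f g : GroupP p e) := by
  change ((FreeExp.lift FreeExp.pow_eq_one f (FreeExp.gen p g) : FreeExp p G) : GroupP p e) = _
  rw [FreeExp.lift_gen]

theorem lift_relator (f : G → FreeExp p G) (h : G) :
    FreeExp.lift FreeExp.pow_eq_one f (relator p e h) =
      iterComm (List.ofFn fun i : Fin n => f (h * e (if i.val + 1 < n then i else ⟨0, i.pos⟩))) := by
  rw [relator, map_iterComm, List.map_ofFn]
  simp [Function.comp_def]

/-- The endomorphism `x_g ↦ x_g ^ (z g)` of `P`. -/
def diagHom (z : G → (ZMod p)ˣ) : GroupP p e →* GroupP p e :=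
  map (fun g => FreeExp.gen p g ^ (z g : ZMod p).val) <| by
    intro h
    let l : List G := List.ofFn fun i : Fin n => h * e (if i.val + 1 < n then i else ⟨0, i.pos⟩)
    -- The rescaled relator equals a power of the relator modulo the term of the lower central
    -- series contained in N.
    have h1 := mk_iterComm_map_pow (FreeExp.gen p) (fun g => (z g : ZMod p).val) l
    have hl : l.length = n := by simp [l]
    have h2 : iterComm (l.map (FreeExp.gen p)) = relator p e h := by
      simp only [l, List.map_ofFn]; rfl
    rw [h2, hl, ← QuotientGroup.mk_pow, eq_comm, QuotientGroup.eq] at h1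
    rw [lift_relator]
    have h3 : relator p e h ^ (l.map fun g => (z g : ZMod p).val).prod ∈ relSubgroup p e :=
      pow_mem (Subgroup.mem_sup_left (Subgroup.subset_closure (Set.mem_range_self h))) _
    have h4 := mul_mem h3 (Subgroup.mem_sup_right h1)
    rw [mul_inv_cancel_left] at h4
    simpa only [l, List.map_ofFn, Function.comp_def] using h4

@[simp]
theorem diagHom_gen (z : G → (ZMod p)ˣ) (g : G) :
    diagHom e z (gen p e g) = gen p e g ^ (z g : ZMod p).val := map_gen _ _ g

theorem diagHom_one [Fact (1 < p)] : diagHom e (1 : G → (ZMod p)ˣ) = MonoidHom.id _ :=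
  hom_ext fun g => by simp [ZMod.val_one]

theorem diagHom_mul [NeZero p] (z z' : G → (ZMod p)ˣ) :
    diagHom e (z * z') = (diagHom e z).comp (diagHom e z') :=
  hom_ext fun g => by
    simp only [diagHom_gen, Pi.mul_apply, Units.val_mul, MonoidHom.comp_apply, map_pow]
    exact pow_val_mul (pow_eq_one _) _ _

/-- The diagonal automorphisms `x_g ↦ x_g ^ (z g)` of `P`. -/
def diag [Fact p.Prime] : (G → (ZMod p)ˣ) →* MulAut (GroupP p e) where
  toFun z := MonoidHom.toMulEquiv (diagHom e z) (diagHom e z⁻¹)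
    (by rw [← diagHom_mul, inv_mul_cancel, diagHom_one])
    (by rw [← diagHom_mul, mul_inv_cancel, diagHom_one])
  map_one' := aut_ext fun g => DFunLike.congr_fun (diagHom_one e) (gen p e g)
  map_mul' z z' := aut_ext fun g => DFunLike.congr_fun (diagHom_mul e z z') (gen p e g)

@[simp]
theorem diag_gen [Fact p.Prime] (z : G → (ZMod p)ˣ) (g : G) :
    diag e z (gen p e g) = gen p e g ^ (z g : ZMod p).val := diagHom_gen e z g

/-- The endomorphism `x_g ↦ x_{h g}` of `P`. -/
def transHom (h : G) : GroupP p e →* GroupP p e :=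
  map (fun g => FreeExp.gen p (h * g)) <| by
    intro k
    rw [lift_relator]
    refine Subgroup.mem_sup_left (Subgroup.subset_closure ⟨h * k, ?_⟩)
    simp only [relator, mul_assoc]

@[simp]
theorem transHom_gen (h g : G) : transHom e h (gen p e g) = gen p e (h * g) := map_gen _ _ g

theorem transHom_one : transHom (p := p) e 1 = MonoidHom.id _ := hom_ext fun g => by simp

theorem transHom_mul (h h' : G) :
    transHom (p := p) e (h * h') = (transHom e h).comp (transHom e h') :=
  hom_ext fun g => by simp [mul_assoc]

/-- The automorphisms `x_g ↦ x_{h g}` of `P`. -/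
def trans : G →* MulAut (GroupP p e) where
  toFun h := MonoidHom.toMulEquiv (transHom e h) (transHom e h⁻¹)
    (by rw [← transHom_mul, inv_mul_cancel, transHom_one])
    (by rw [← transHom_mul, mul_inv_cancel, transHom_one])
  map_one' := aut_ext fun g => DFunLike.congr_fun (transHom_one e) (gen p e g)
  map_mul' z z' := aut_ext fun g => DFunLike.congr_fun (transHom_mul e z z') (gen p e g)

@[simp]
theorem trans_gen (h g : G) : trans e h (gen p e g) = gen p e (h * g) := transHom_gen e h g

theorem trans_mul_diag [Fact p.Prime] (h : G) (z : G → (ZMod p)ˣ) :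
    trans e h * diag e z = diag e (fun g => z (h⁻¹ * g)) * trans e h :=
  aut_ext fun g => by simp [MulAut.mul_apply]

variable {e} in
/-- The exponent sum of the generator `x_k`, modulo `p`. -/
def deg [DecidableEq G] (hn : 2 ≤ n) (k : G) : GroupP p e →* Multiplicative (ZMod p) :=
  QuotientGroup.lift (relSubgroup p e)
    (FreeExp.lift multiplicative_zmod_pow_eq_one
      fun g => Multiplicative.ofAdd (if g = k then 1 else 0)) <| by
    set f : FreeExp p G →* Multiplicative (ZMod p) := FreeExp.lift _ _
    have hker : (⊤ : Subgroup (FreeExp p G)).lowerCentralSeries 1 ≤ f.ker := by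
      rw [Subgroup.lowerCentralSeries_succ, Subgroup.commutator_le]
      intro x _ y _
      rw [MonoidHom.mem_ker, map_commutatorElement, commutatorElement_eq_one_iff_mul_comm, mul_comm]
    refine sup_le ?_ ((Subgroup.lowerCentralSeries_antitone _ (by simp; omega)).trans hker)
    rw [Subgroup.closure_le]
    rintro _ ⟨h, rfl⟩
    have h1 := iterComm_mem (List.ofFn fun i : Fin n =>
      FreeExp.gen p (h * e (if i.val + 1 < n then i else ⟨0, i.pos⟩)))
    rw [List.length_ofFn] at h1
    exact hker (Subgroup.lowerCentralSeries_antitone _ (by omega) h1)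

variable {e} in
@[simp]
theorem deg_gen [DecidableEq G] (hn : 2 ≤ n) (k g : G) :
    deg hn k (gen p e g) = Multiplicative.ofAdd (if g = k then 1 else 0) := by
  exact FreeExp.lift_gen (K := Multiplicative (ZMod p)) multiplicative_zmod_pow_eq_one
    (fun g => Multiplicative.ofAdd (if g = k then 1 else 0)) g

/-- Both sides are homomorphisms in x, so the generators decide. Exponent sums thus read off the
coordinates of a diagonal automorphism. -/
theorem deg_diag [Fact p.Prime] [DecidableEq G] (hn : 2 ≤ n) (k : G) (z : G → (ZMod p)ˣ)
    (x : GroupP p e) : deg hn k (diag e z x) = deg hn k x ^ (z k : ZMod p).val := by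
  have : (deg hn k).comp (diag e z).toMonoidHom =
      (powMonoidHom (z k : ZMod p).val).comp (deg hn k) := by
    refine hom_ext fun g => ?_
    simp only [MulEquiv.toMonoidHom_eq_coe, MonoidHom.coe_comp, MonoidHom.coe_coe,
      Function.comp_apply, diag_gen, map_pow, deg_gen, powMonoidHom_apply]
    split_ifs with h
    · rw [h]
    · simp
  exact DFunLike.congr_fun this x

theorem toAdd_deg_diag [Fact p.Prime] [DecidableEq G] (hn : 2 ≤ n) (k : G) (z : G → (ZMod p)ˣ)
    (x : GroupP p e) : (deg hn k (diag e z x)).toAdd = z k * (deg hn k x).toAdd := by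
  rw [deg_diag, toAdd_pow, nsmul_eq_mul, ZMod.natCast_zmod_val]

theorem diag_injective [Fact p.Prime] (hn : 2 ≤ n) : Function.Injective (diag (p := p) e) := by
  classical
  intro z z' h
  ext k
  have h1 := toAdd_deg_diag e hn k z (gen p e k)
  rw [h, toAdd_deg_diag] at h1
  simpa [eq_comm] using h1

/-! ### Fixed points of diagonal automorphisms -/

/-- In a nonempty list of length less than `p`, either the associated iterated commutator is a
generator or trivial, or some letter different from `i` has a multiplicity strictly between `0`
and `p - 1`. -/
theorem exists_count_lt {Γ α : Type*} [Group Γ] [DecidableEq α] (f : α → Γ) (i : α) {l : List α}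
    (hl : l ≠ []) (hp : 3 ≤ p) (hlp : l.length < p) :
    l = [i] ∨ iterComm (l.map f) = 1 ∨ ∃ j, j ≠ i ∧ 0 < l.count j ∧ l.count j < p - 1 := by
  obtain ⟨a, l', rfl⟩ := List.exists_cons_of_ne_nil hl
  by_cases h : ∃ b ∈ a :: l', a ≠ b
  · right; right
    obtain ⟨b, hb, hab⟩ := h
    have hlt : ∀ j, (a :: l').count j < p - 1 := by
      intro j
      have h1 : (a :: l').count j ≤ (a :: l').length := List.count_le_length
      have h2 : (a :: l').count j ≠ (a :: l').length := by
        intro h3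
        rw [List.count_eq_length] at h3
        exact hab ((h3 a (by simp)).symm.trans (h3 b hb))
      omega
    by_cases ha : a = i
    · exact ⟨b, fun hbi => hab (ha.trans hbi.symm), List.count_pos_iff.2 hb, hlt b⟩
    · exact ⟨a, ha, List.count_pos_iff.2 (by simp), hlt a⟩
  · push Not at h
    have hrep : a :: l' = List.replicate (l'.length + 1) a :=
      List.eq_replicate_iff.2 ⟨rfl, fun b hb => (h b hb).symm⟩
    rcases Nat.eq_zero_or_pos l'.length with h0 | h0
    · rw [List.length_eq_zero_iff] at h0
      subst h0
      by_cases ha : a = i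
      · exact Or.inl (by rw [ha])
      · exact Or.inr (Or.inr ⟨a, ha, by simp, by simp; omega⟩)
    · right; left
      obtain ⟨m, hm⟩ : ∃ m, l'.length = m + 1 := ⟨l'.length - 1, by omega⟩
      rw [hrep, List.map_replicate, hm, iterComm_replicate]

theorem prod_map_mulSingle {M α : Type*} [CommMonoid M] [DecidableEq α] (j : α) (ζ : M)
    (l : List α) : (l.map (Pi.mulSingle j ζ : α → M)).prod = ζ ^ l.count j := by
  induction l with
  | nil => simp
  | cons a l ih =>
    rw [List.map_cons, List.prod_cons, ih, List.count_cons]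
    by_cases h : a = j
    · subst h; simp [pow_succ, mul_comm]
    · simp [h]

variable {e} in
/-- If an element of the `k`-th term of the lower central series is fixed by the diagonal
automorphisms that fix `x_i`, then modulo the next term it is a power of `x_i` if `k = 0`, and
trivial otherwise. -/
theorem mk_mem_of_fixed [Finite G] [Fact p.Prime] (hp : 3 ≤ p) (hnp : n < p) {i : G}
    {y : GroupP p e} (hy : ∀ z : G → (ZMod p)ˣ, z i = 1 → diag e z y = y) {k : ℕ} (hk : k < n)
    (hyk : y ∈ (⊤ : Subgroup (GroupP p e)).lowerCentralSeries k)
    (B : Subgroup (GroupP p e ⧸ (⊤ : Subgroup (GroupP p e)).lowerCentralSeries (k + 1)))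
    (hB : k = 0 → (gen p e i : GroupP p e ⧸ _) ∈ B) :
    (y : GroupP p e ⧸ (⊤ : Subgroup (GroupP p e)).lowerCentralSeries (k + 1)) ∈ B := by
  classical
  have hpp : p.Prime := Fact.out
  have := Fintype.ofFinite G
  let A : Subgroup (G → (ZMod p)ˣ) := (Pi.evalMonoidHom _ i).ker
  let π := QuotientGroup.mk' ((⊤ : Subgroup (GroupP p e)).lowerCentralSeries (k + 1))
  let C : Set (GroupP p e ⧸ (⊤ : Subgroup (GroupP p e)).lowerCentralSeries (k + 1)) :=
    π '' {y | ∃ l : List G, l.length = k + 1 ∧ y = iterComm (l.map (gen p e))}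
  obtain ⟨ζ, hζ⟩ := IsCyclic.exists_generator (α := (ZMod p)ˣ)
  have hord : orderOf ζ = p - 1 := by
    rw [orderOf_eq_card_of_forall_mem_zpowers hζ, Nat.card_eq_fintype_card, ZMod.card_units]
  have hcard : (Nat.card A).Coprime p := by
    refine Nat.Coprime.coprime_dvd_left (Subgroup.card_subgroup_dvd_card A) ?_
    rw [Nat.card_pi, Finset.prod_const, Nat.card_eq_fintype_card, ZMod.card_units]
    exact Nat.Coprime.pow_left _ ((Nat.coprime_self_sub_left hpp.one_lt.le).2 (by simp))
  refine mem_of_fixed hpp hcard (fun x => ?_) ((quotientAut _).comp ((diag e).comp A.subtype))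
    (C := C) ?_ B ?_ ?_ fun a => ?_
  · obtain ⟨x, rfl⟩ := QuotientGroup.mk_surjective x
    rw [← QuotientGroup.mk_pow, pow_eq_one]; rfl
  · rintro _ ⟨_, ⟨l, hl, rfl⟩, rfl⟩
    obtain ⟨a, l, rfl⟩ := List.exists_cons_of_length_eq_add_one hl
    refine mk_mem_center_of_mem_lowerCentralSeries ?_
    have h1 := iterComm_mem_lowerCentralSeries (gen p e a) (l.map (gen p e))
    rw [List.length_map] at h1
    rw [List.length_cons, Nat.add_right_cancel_iff] at hl
    rwa [hl] at h1
  · rintro _ ⟨_, ⟨l, hl, rfl⟩, rfl⟩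
    have hl0 : l ≠ [] := by rintro rfl; simp at hl
    rcases exists_count_lt (p := p) (gen p e) i hl0 hp (by omega) with h | h | ⟨j, hji, hj0, hj⟩
    · subst h
      have hk0 : k = 0 := by simpa using hl.symm
      refine Or.inl ⟨hB hk0, fun a => ?_⟩
      have ha : (a : G → (ZMod p)ˣ) i = 1 := a.2
      change π (diag e a (gen p e i)) = π (gen p e i)
      have : Fact (1 < p) := ⟨hpp.one_lt⟩
      rw [diag_gen, ha, Units.val_one, ZMod.val_one, pow_one]
    · rw [h, map_one]
      exact Or.inl ⟨one_mem B, fun a => map_one _⟩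
    -- Rescaling x_j alone by ζ multiplies the commutator by the eigenvalue ζ^(count of j), which is
    -- not 1 because 0 < count < p − 1 = ord ζ.
    · refine Or.inr ⟨⟨Pi.mulSingle j ζ, ?_⟩,
        (l.map fun g => ((Pi.mulSingle j ζ : G → (ZMod p)ˣ) g : ZMod p).val).prod, ?_, ?_⟩
      · change (Pi.mulSingle j ζ : G → (ZMod p)ˣ) i = 1
        rw [Pi.mulSingle_eq_of_ne hji.symm]
      · have h1 := mk_iterComm_map_pow (gen p e)
          (fun g => ((Pi.mulSingle j ζ : G → (ZMod p)ˣ) g : ZMod p).val) l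
        rw [hl] at h1
        refine Eq.trans ?_ h1
        change π (diag e (Pi.mulSingle j ζ) (iterComm (l.map (gen p e)))) = π _
        congr 1
        have h2 := map_iterComm (diag e (Pi.mulSingle j ζ)).toMonoidHom (l.map (gen p e))
        refine h2.trans ?_
        rw [List.map_map]
        congr 2
        funext g
        exact diag_gen e _ g
      · intro h
        have h1 := (ZMod.natCast_eq_natCast_iff _ _ p).2 h
        rw [Nat.cast_list_prod, List.map_map] at h1
        have h2 : (Nat.cast ∘ fun g => ((Pi.mulSingle j ζ : G → (ZMod p)ˣ) g : ZMod p).val) =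
            (Units.coeHom (ZMod p)) ∘ (Pi.mulSingle j ζ : G → (ZMod p)ˣ) := by
          funext g
          simp
        rw [h2, ← List.map_map, ← map_list_prod, prod_map_mulSingle, Nat.cast_one] at h1
        have h3 : ζ ^ l.count j = 1 := Units.ext h1
        have h4 := Nat.le_of_dvd hj0 (orderOf_dvd_of_pow_eq_one h3)
        omega
  · rw [lowerCentralSeries_eq_closure_sup (closure_range_gen e) k] at hyk
    have h1 := Subgroup.mem_map_of_mem π hyk
    rw [Subgroup.map_sup,
      (Subgroup.map_eq_bot_iff (f := π) (_ : Subgroup _)).2 (QuotientGroup.ker_mk' _).ge,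
      sup_bot_eq, MonoidHom.map_closure] at h1
    exact h1
  · exact congrArg π (hy a a.2)

variable {e} in
/-- The elements of `P` fixed by the diagonal automorphisms that fix `x_i` are the powers
of `x_i`. -/
theorem mem_zpowers_of_fixed [Finite G] [Fact p.Prime] (hp : 3 ≤ p) (hnp : n < p) {i : G}
    {y : GroupP p e} (hy : ∀ z : G → (ZMod p)ˣ, z i = 1 → diag e z y = y) :
    y ∈ Subgroup.zpowers (gen p e i) := by
  have hn : 0 < n := (e.symm i).pos
  have : Fact (1 < p) := ⟨by omega⟩
  obtain ⟨c, hc⟩ := mk_mem_of_fixed hp hnp hy hn (Subgroup.mem_top y)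
    (Subgroup.zpowers (gen p e i : GroupP p e ⧸ _)) fun _ => Subgroup.mem_zpowers _
  have hc2 : ((gen p e i ^ c)⁻¹ * y) ∈ (⊤ : Subgroup (GroupP p e)).lowerCentralSeries 1 :=
    QuotientGroup.eq.1 hc
  -- The quotient t is again fixed and starts one level down, where no fixed classes survive; it
  -- descends through the whole series and is trivial.
  set t := (gen p e i ^ c)⁻¹ * y with ht
  have htf : ∀ z : G → (ZMod p)ˣ, z i = 1 → diag e z t = t := by
    intro z hz
    rw [ht, map_mul, hy z hz, map_inv, map_zpow, diag_gen, hz, Units.val_one, ZMod.val_one, pow_one]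
  have hmem (k : ℕ) (hk : k + 1 ≤ n) :
      t ∈ (⊤ : Subgroup (GroupP p e)).lowerCentralSeries (k + 1) := by
    induction k with
    | zero => exact hc2
    | succ k ih =>
      have := mk_mem_of_fixed hp hnp htf (by omega) (ih (by omega)) ⊥ (by simp)
      rwa [Subgroup.mem_bot, QuotientGroup.eq_one_iff] at this
  have h1 := hmem (n - 1) (by omega)
  rw [Nat.sub_add_cancel hn, lowerCentralSeries_eq_bot, Subgroup.mem_bot] at h1
  exact ⟨c, by simpa using (inv_mul_eq_one.1 h1)⟩

/-! ### Identification of Q -/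

variable {e} in
theorem isDiagAut_iff [Fact p.Prime] [DecidableEq G] {ζ : (ZMod p)ˣ} {i : G}
    {q : MulAut (GroupP p e)} : IsDiagAut e ζ i q ↔ q = diag e (Pi.mulSingle i ζ) := by
  have hd : IsDiagAut e ζ i (diag e (Pi.mulSingle i ζ)) := by
    have : Fact (1 < p) := ⟨(Fact.out : p.Prime).one_lt⟩
    refine ⟨by simp, fun j hj => by simp [hj, ZMod.val_one]⟩
  constructor
  · intro h
    refine aut_ext fun g => ?_
    by_cases hg : g = i
    · rw [hg, h.1, hd.1]
    · rw [h.2 g hg, hd.2 g hg]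
  · rintro rfl
    exact hd

/-- A tuple z is the product of its coordinate parts, and each of these is a power of the one given
by the generator ζ. -/
theorem groupQ_eq_range [Finite G] [Fact p.Prime] {ζ : (ZMod p)ˣ}
    (hζ : ∀ z : (ZMod p)ˣ, z ∈ Subgroup.zpowers ζ) : groupQ e ζ = (diag e).range := by
  classical
  have := Fintype.ofFinite G
  apply le_antisymm
  · rw [groupQ, Subgroup.closure_le]
    rintro q ⟨i, hq⟩
    exact ⟨_, (isDiagAut_iff.1 hq).symm⟩
  · rintro _ ⟨z, rfl⟩
    rw [← Finset.univ_prod_mulSingle z]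
    suffices h : ∀ i, (Pi.mulSingle i (z i) : G → (ZMod p)ˣ) ∈ (groupQ e ζ).comap (diag e) from
      Subgroup.prod_mem ((groupQ e ζ).comap (diag e)) fun i _ => h i
    intro i
    obtain ⟨m, hm⟩ := hζ (z i)
    rw [← hm]
    have h1 : (Pi.mulSingle i (ζ ^ m) : G → (ZMod p)ˣ) = Pi.mulSingle i ζ ^ m :=
      map_zpow (MonoidHom.mulSingle (fun _ : G => (ZMod p)ˣ) i) ζ m
    rw [h1]
    refine zpow_mem ?_ m
    exact Subgroup.subset_closure ⟨i, isDiagAut_iff.2 rfl⟩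

end GroupP

end GroupP

end FiniteOut

namespace FiniteOut

open scoped commutatorElement
open SemidirectProduct (inl inr)

/-! ### Automorphisms of a semidirect product by a coprime group -/

section Semidirect

variable {P : Type*} [Group P] (Q : Subgroup (MulAut P))

/-- Automorphisms of `P` that normalize `Q` act on the semidirect product `P ⋊ Q`. -/
def normalizerAut : Subgroup.normalizer (Q : Set (MulAut P)) →* MulAut (P ⋊[Q.subtype] Q) where
  toFun β :=
    { toFun := fun x => ⟨β.1 x.left, ⟨β.1 * x.right.1 * β.1⁻¹,
        (Subgroup.mem_normalizer_iff.1 β.2 x.right.1).1 x.right.2⟩⟩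
      invFun := fun x => ⟨β.1⁻¹ x.left, ⟨β.1⁻¹ * x.right.1 * β.1,
        (Subgroup.mem_normalizer_iff''.1 β.2 x.right.1).1 x.right.2⟩⟩
      left_inv := fun x => by
        ext1
        · simp
        · exact Subtype.ext (by simp only; group)
      right_inv := fun x => by
        ext1
        · simp
        · exact Subtype.ext (by simp only; group)
      map_mul' := fun x y => by
        ext1
        · simp [MulAut.mul_apply]
        · refine Subtype.ext ?_
          simp only [SemidirectProduct.mul_right, Subgroup.coe_mul]
          group }
  map_one' := by
    ext x : 2
    · simp
    · simp
  map_mul' β β' := by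
    ext x : 2
    · rfl
    · refine Subtype.ext ?_
      simp only [Subgroup.coe_mul, MulAut.mul_apply, MulEquiv.coe_mk, Equiv.coe_fn_mk]
      group

variable {Q}

theorem normalizerAut_inl (β : Subgroup.normalizer (Q : Set (MulAut P))) (x : P) :
    normalizerAut Q β (inl x) = inl (β.1 x) := by
  ext1
  · rfl
  · exact Subtype.ext (by simp [normalizerAut])

theorem normalizerAut_inr (β : Subgroup.normalizer (Q : Set (MulAut P))) (q : Q) :
    normalizerAut Q β (inr q) = inr ⟨β.1 * q.1 * β.1⁻¹,
      (Subgroup.mem_normalizer_iff.1 β.2 q.1).1 q.2⟩ := by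
  ext1
  · simp [normalizerAut]
  · rfl

theorem normalizerAut_eq_conj (q : Q) :
    normalizerAut Q ⟨q, Subgroup.le_normalizer q.2⟩ = MulAut.conj (inr q) := by
  refine MulEquiv.toMonoidHom_injective (SemidirectProduct.hom_ext ?_ ?_)
  · ext1 x
    change normalizerAut Q ⟨q, _⟩ (inl x) = inr q * inl x * (inr q)⁻¹
    rw [normalizerAut_inl, ← map_inv]
    exact SemidirectProduct.inl_aut (φ := Q.subtype) q x
  · ext1 r
    refine (normalizerAut_inr _ r).trans ?_
    change inr (q * r * q⁻¹) = inr q * inr r * (inr q)⁻¹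
    rw [map_mul, map_mul, map_inv]

/-- An automorphism of `P ⋊ Q` that preserves both factors comes from the normalizer of `Q`. -/
theorem exists_eq_normalizerAut [Finite Q] (α : MulAut (P ⋊[Q.subtype] Q))
    (h₁ : ∀ x, (α (inl x)).right = 1) (h₂ : ∀ x, (α⁻¹ (inl x)).right = 1)
    (h₃ : ∀ q, (α (inr q)).left = 1) : ∃ β, α = normalizerAut Q β := by
  have h₁' (x : P) : inl (α (inl x)).left = α (inl x) := by
    ext1
    · simp
    · exact (h₁ x).symm
  have h₂' (x : P) : inl (α⁻¹ (inl x)).left = α⁻¹ (inl x) := by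
    ext1
    · simp
    · exact (h₂ x).symm
  have h₃' (q : Q) : inr (α (inr q)).right = α (inr q) := by
    ext1
    · simp [h₃]
    · simp
  let β : MulAut P :=
    { toFun := fun x => (α (inl x)).left
      invFun := fun x => (α⁻¹ (inl x)).left
      left_inv := fun x => by
        simp only [h₁', MulAut.inv_apply_self, SemidirectProduct.left_inl]
      right_inv := fun x => by
        simp only [h₂', MulAut.apply_inv_self, SemidirectProduct.left_inl]
      map_mul' := fun x y => by
        rw [map_mul, map_mul, SemidirectProduct.mul_left, h₁, map_one, MulAut.one_apply] }
  have hβ (x : P) : α (inl x) = inl (β x) := (h₁' x).symm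
  -- Applying α to the relation q x q⁻¹ = q(x) in the semidirect product shows that β conjugates Q
  -- into itself; finiteness of Q then puts β in the normalizer.
  have hconj (q : Q) : β * q.1 * β⁻¹ = (α (inr q)).right.1 := by
    rw [mul_inv_eq_iff_eq_mul]
    ext x
    apply SemidirectProduct.inl_injective (φ := Q.subtype)
    rw [MulAut.mul_apply, MulAut.mul_apply, ← hβ]
    have h1 := SemidirectProduct.inl_aut (φ := Q.subtype) q x
    have h2 := SemidirectProduct.inl_aut (φ := Q.subtype) (α (inr q)).right (β x)
    rw [Subgroup.subtype_apply] at h1 h2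
    rw [h1, h2, map_mul, map_mul, hβ, h₃', map_inv, map_inv, map_inv, h₃']
  have hn : β ∈ Subgroup.normalizer (Q : Set (MulAut P)) := by
    have : Finite (Q : Set (MulAut P)) := ‹Finite Q›
    refine Subgroup.mem_normalizer_fintype fun q hq => ?_
    rw [hconj ⟨q, hq⟩]
    exact Subtype.property _
  refine ⟨⟨β, hn⟩, MulEquiv.toMonoidHom_injective (SemidirectProduct.hom_ext ?_ ?_)⟩
  · ext1 x
    change α (inl x) = normalizerAut Q ⟨β, hn⟩ (inl x)
    rw [normalizerAut_inl, hβ]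
  · ext1 q
    refine Eq.trans ?_ (normalizerAut_inr _ q).symm
    refine (h₃' q).symm.trans ?_
    exact congrArg inr (Subtype.ext (hconj q).symm)

/-- If `P` is nilpotent of exponent `p` and the order of `Q` is prime to `p`, then modulo inner
automorphisms, every automorphism of `P ⋊ Q` comes from the normalizer of `Q`. -/
theorem exists_conj_mul_eq_normalizerAut [Group.IsNilpotent P] [Finite Q] {p : ℕ} (hp : p.Prime)
    (hQ : (Nat.card Q).Coprime p) (hP : ∀ x : P, x ^ p = 1) (α : MulAut (P ⋊[Q.subtype] Q)) :
    ∃ c β, MulAut.conj c * α = normalizerAut Q β := by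
  -- The Q-component of the image of an element of P has order dividing both p and |Q|.
  have hright (α : MulAut (P ⋊[Q.subtype] Q)) (x : P) : (α (inl x)).right = 1 := by
    have h1 : (α (inl x)).right ^ p = 1 := by
      change SemidirectProduct.rightHom (α (inl x)) ^ p = 1
      have h2 := congrArg SemidirectProduct.rightHom
        (congrArg α (congrArg (inl (φ := Q.subtype)) (hP x)))
      simpa only [map_pow, map_one] using h2
    have h2 := orderOf_dvd_natCard (α (inl x)).right
    have h3 := orderOf_dvd_of_pow_eq_one h1
    rw [← orderOf_eq_one_iff]
    exact Nat.eq_one_of_dvd_coprimes hQ h2 h3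
  let θ : Q →* Q := SemidirectProduct.rightHom.comp (α.toMonoidHom.comp inr)
  -- The P-component of α on Q is a crossed homomorphism for the action twisted by θ. Writing it as
  -- a coboundary of u, conjugation by u⁻¹ moves α(Q) back into Q.
  obtain ⟨u, hu⟩ := crossedHom_principal P hp hQ hP (Q.subtype.comp θ)
    (fun q => (α (inr q)).left) (fun q r => by
      rw [map_mul, map_mul, SemidirectProduct.mul_left]
      rfl)
  refine ⟨inl u⁻¹, exists_eq_normalizerAut _ (hright _) (hright _) fun q => ?_⟩
  have h1 : α (inr q) = inl (u * (Q.subtype (θ q) u)⁻¹) * inr (θ q) := by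
    ext1
    · rw [SemidirectProduct.mul_left]
      simpa using hu q
    · simp [θ]
  rw [MulAut.mul_apply, MulAut.conj_apply, h1]
  simp

end Semidirect

/-! ### The normalizer of the diagonal group and the outer automorphisms -/

namespace GroupP

variable {G : Type u} [Group G] {p n : ℕ} [Fact p.Prime] {e : Fin n ≃ G}

theorem nonempty_mulEquiv_pi (hn : 2 ≤ n) :
    Nonempty ((diag (p := p) e).range ≃* (Fin n → Multiplicative (ZMod (p - 1)))) := by
  have hcard : Nat.card (ZMod p)ˣ = p - 1 := by
    rw [Nat.card_eq_fintype_card, ZMod.card_units]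
  have u := zmodCyclicMulEquiv (inferInstance : IsCyclic (ZMod p)ˣ)
  rw [hcard] at u
  exact ⟨(MonoidHom.ofInjective (diag_injective e hn)).symm.trans
    (MulEquiv.arrowCongr e.symm u.symm)⟩

/-- A bijection of the generators that extends to an automorphism of `P` is a translation. -/
theorem eq_trans_of_apply_gen (hn : 3 ≤ n) (hnp : n < p) {β : MulAut (GroupP p e)}
    {σ : Equiv.Perm G} (h : ∀ g, β (gen p e g) = gen p e (σ g)) : ∃ g, β = trans e g := by
  obtain ⟨k, hk⟩ := exists_eq_mul_of_relator_mem hn Fact.out hnp e σ <| by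
    rw [← QuotientGroup.eq_one_iff]
    have h1 : relator p e 1 ∈ relSubgroup p e :=
      Subgroup.mem_sup_left (Subgroup.subset_closure ⟨1, rfl⟩)
    have h2 : β.toMonoidHom (QuotientGroup.mk' (relSubgroup p e) (relator p e 1)) = 1 := by
      rw [show QuotientGroup.mk' (relSubgroup p e) (relator p e 1) = 1 from
        (QuotientGroup.eq_one_iff _).2 h1, map_one]
    rw [relator, map_iterComm, map_iterComm, List.map_ofFn, List.map_ofFn] at h2
    change QuotientGroup.mk' (relSubgroup p e) _ = 1
    rw [map_iterComm, List.map_ofFn, ← h2]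
    congr 2
    funext i
    simp only [one_mul]
    exact (h _).symm
  exact ⟨k, aut_ext fun g => by rw [h, hk, trans_gen]⟩

variable [Finite G]

theorem trans_mem_normalizer (h : G) :
    trans e h ∈ Subgroup.normalizer ((diag (p := p) e).range : Set (MulAut (GroupP p e))) := by
  have : Finite ((diag (p := p) e).range : Set (MulAut (GroupP p e))) :=
    (Set.finite_range (diag (p := p) e)).to_subtype
  refine Subgroup.mem_normalizer_fintype ?_
  rintro _ ⟨z, rfl⟩
  exact ⟨_, (mul_inv_eq_iff_eq_mul.2 (trans_mul_diag e h z)).symm⟩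

/-- The normalizer of the group of diagonal automorphisms in `Aut(P)`. -/
theorem exists_eq_diag_mul_trans (hn : 3 ≤ n) (hnp : n < p) {β : MulAut (GroupP p e)}
    (hβ : β ∈ Subgroup.normalizer ((diag (p := p) e).range : Set (MulAut (GroupP p e)))) :
    ∃ z h, β = diag e z * trans e h := by
  classical
  have hn2 : 2 ≤ n := by omega
  have : Fact (1 < p) := ⟨(Fact.out : p.Prime).one_lt⟩
  have hθ (z : G → (ZMod p)ˣ) : ∃ z', diag e z' = β * diag e z * β⁻¹ :=
    (Subgroup.mem_normalizer_iff.1 hβ (diag e z)).1 ⟨z, rfl⟩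
  choose θ hθ using hθ
  have hθx (z : G → (ZMod p)ˣ) (x : GroupP p e) : diag e (θ z) (β x) = β (diag e z x) := by
    rw [hθ]; simp [MulAut.mul_apply]
  -- Otherwise the exponent sum in x_k would vanish on the image of β, which is all of P.
  have hτ (k : G) : ∃ i, (deg hn2 k (β (gen p e i))).toAdd ≠ 0 := by
    by_contra! h
    have h1 : (deg hn2 k).comp β.toMonoidHom = 1 := hom_ext fun g => h g
    have h2 := DFunLike.congr_fun h1 (β⁻¹ (gen p e k))
    simp at h2
  choose τ hτ using hτ
  have hθτ (z : G → (ZMod p)ˣ) (k : G) : θ z k = z (τ k) := by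
    have h1 := congrArg (fun x => (deg hn2 k x).toAdd) (hθx z (gen p e (τ k)))
    simp only [toAdd_deg_diag, diag_gen, map_pow, toAdd_pow, nsmul_eq_mul,
      ZMod.natCast_zmod_val] at h1
    exact Units.ext (mul_right_cancel₀ (hτ k) h1)
  -- If τ missed i, a nontrivial rescaling of x_i alone would be conjugated by β to the identity.
  have hsurj : Function.Surjective τ := by
    intro i
    by_contra! h
    have : Nontrivial (ZMod p)ˣ := by
      rw [← Fintype.one_lt_card_iff_nontrivial, ZMod.card_units]
      omega
    obtain ⟨ζ, hζ⟩ := exists_ne (1 : (ZMod p)ˣ)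
    have h1 : θ (Pi.mulSingle i ζ) = 1 := by
      funext k
      rw [hθτ, Pi.mulSingle_eq_of_ne (h k)]; rfl
    have h2 := hθ (Pi.mulSingle i ζ)
    rw [h1, map_one, eq_comm, mul_inv_eq_one, mul_eq_left, ← map_one (diag e)] at h2
    have h3 := congrFun (diag_injective e hn2 h2) i
    rw [Pi.mulSingle_eq_same] at h3
    exact hζ h3
  let τe : G ≃ G := Equiv.ofBijective τ ⟨Finite.injective_iff_surjective.2 hsurj, hsurj⟩
  -- Conjugation by β matches the diagonal automorphisms fixing x_k with those fixing x_{τ k}, so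
  -- the image of x_{τ k} is fixed by the former.
  have hfix (k : G) : β (gen p e (τ k)) ∈ Subgroup.zpowers (gen p e k) := by
    refine mem_zpowers_of_fixed (by omega) hnp fun z hz => ?_
    have h1 : θ (z ∘ τe.symm) = z := by
      funext i
      rw [hθτ]
      exact congrArg z (τe.symm_apply_apply i)
    have h2 : z (τe.symm (τ k)) = 1 := by rw [← hz]; exact congrArg z (τe.symm_apply_apply k)
    rw [← h1, hθx, diag_gen, Function.comp_apply, h2, Units.val_one, ZMod.val_one, pow_one]
  choose c hc using fun k => Subgroup.mem_zpowers_iff.1 (hfix k)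
  have hc0 (k : G) : (c k : ZMod p) ≠ 0 := by
    intro h
    apply hτ k
    rw [← hc, map_zpow, toAdd_zpow, zsmul_eq_mul, h, zero_mul]
  let w : G → (ZMod p)ˣ := fun k => Units.mk0 (c k : ZMod p) (hc0 k)
  have hw (k : G) : β (gen p e (τ k)) = diag e w (gen p e k) := by
    rw [← hc, diag_gen, ← zpow_natCast, zpow_eq_zpow_iff_modEq]
    refine Int.ModEq.of_dvd (n := (p : ℤ))
      (Int.natCast_dvd_natCast.2 (orderOf_dvd_of_pow_eq_one (pow_eq_one _))) ?_
    rw [← ZMod.intCast_eq_intCast_iff]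
    simp [w]
  obtain ⟨h, hh⟩ := eq_trans_of_apply_gen hn hnp (β := (diag e w)⁻¹ * β) (σ := τe.symm) fun g => by
    obtain ⟨k, rfl⟩ := τe.surjective g
    rw [MulAut.mul_apply, τe.symm_apply_apply]
    change (diag e w)⁻¹ (β (gen p e (τ k))) = _
    rw [hw, MulAut.inv_apply_self]
  exact ⟨w, h, by rw [← hh, mul_inv_cancel_left]⟩

variable (e) in
/-- The homomorphism `G → Out(P ⋊ Q)` given by translation of the generators. -/
def outHom : G →* Out (GroupP p e ⋊[(diag (p := p) e).range.subtype] (diag (p := p) e).range) :=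
  (QuotientGroup.mk' (Inn _)).comp
    ((normalizerAut (diag (p := p) e).range).comp
      ((trans e).codRestrict _ trans_mem_normalizer))

theorem outHom_injective (hn : 2 ≤ n) : Function.Injective (outHom (p := p) e) := by
  classical
  rw [injective_iff_map_eq_one]
  intro g hg
  obtain ⟨c, hc⟩ := (QuotientGroup.eq_one_iff _).1 hg
  have h1 : inl (trans e g (gen p e 1)) = MulAut.conj c (inl (gen p e 1)) := by
    rw [hc]
    exact (normalizerAut_inl (⟨trans e g, trans_mem_normalizer g⟩ :
      Subgroup.normalizer ((diag (p := p) e).range : Set (MulAut (GroupP p e)))) _).symm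
  have h2 := congrArg SemidirectProduct.left h1
  obtain ⟨z, hz⟩ := c.right.2
  simp only [MulAut.conj_apply, SemidirectProduct.mul_left, SemidirectProduct.left_inl, trans_gen,
    SemidirectProduct.mul_right, SemidirectProduct.right_inl, mul_one,
    SemidirectProduct.inv_left, map_inv, Subgroup.subtype_apply, MulAut.apply_inv_self, ← hz] at h2
  -- Conjugation in H can only rescale x_1 modulo commutators, whereas translation gives x_g. For g
  -- ≠ 1 the exponent sums in x_g are 0 and 1.
  have h3 := congrArg (fun x => (deg hn g x).toAdd) h2
  simp only [map_mul, map_inv, toAdd_mul, toAdd_inv, toAdd_deg_diag, deg_gen, toAdd_ofAdd] at h3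
  by_contra hg1
  simp [Ne.symm hg1] at h3

theorem card_range_diag_coprime : (Nat.card (diag (p := p) e).range).Coprime p := by
  have := Fintype.ofFinite G
  have hpp : p.Prime := Fact.out
  refine Nat.Coprime.coprime_dvd_left (Subgroup.card_range_dvd (diag (p := p) e)) ?_
  rw [Nat.card_pi, Finset.prod_const, Nat.card_eq_fintype_card, ZMod.card_units]
  exact Nat.Coprime.pow_left _ ((Nat.coprime_self_sub_left hpp.one_lt.le).2 (by simp))

instance : Finite (diag (p := p) e).range := (Set.finite_range (diag (p := p) e)).to_subtype

/-- The normalizer is diagonal times translations, and the diagonal factor is conjugation by an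
element of Q, hence trivial in Out. -/
theorem outHom_surjective (hn : 3 ≤ n) (hnp : n < p) :
    Function.Surjective (outHom (p := p) e) := by
  intro a
  obtain ⟨α, rfl⟩ := QuotientGroup.mk_surjective a
  obtain ⟨c, ⟨β, hβ⟩, h⟩ := exists_conj_mul_eq_normalizerAut (Fact.out : p.Prime)
    card_range_diag_coprime pow_eq_one α
  obtain ⟨z, g, rfl⟩ := exists_eq_diag_mul_trans hn hnp hβ
  have h1 : normalizerAut (diag (p := p) e).range ⟨_, hβ⟩ =
      MulAut.conj (inr ⟨diag e z, z, rfl⟩) *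
        normalizerAut (diag (p := p) e).range ⟨trans e g, trans_mem_normalizer g⟩ := by
    rw [← normalizerAut_eq_conj, ← map_mul]
    rfl
  have h2 (d : GroupP p e ⋊[(diag (p := p) e).range.subtype] (diag (p := p) e).range) :
      QuotientGroup.mk' (Inn _) (MulAut.conj d) = 1 := (QuotientGroup.eq_one_iff _).2 ⟨d, rfl⟩
  have h3 := congrArg (QuotientGroup.mk' (Inn _)) (h.trans h1)
  rw [map_mul, map_mul, h2, h2, one_mul, one_mul] at h3
  exact ⟨g, h3.symm⟩

end GroupP

/-! ### Small orders and the theorem -/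

/-- The cyclic group of order 3 is abelian with two automorphisms; the universe lift places it
beside G. -/
theorem nonempty_out_mulEquiv_of_card_eq_two {G : Type u} [Group G] (hG : Nat.card G = 2) :
    ∃ (H : Type u) (_ : Group H), Finite H ∧ Nonempty (Out H ≃* G) := by
  refine ⟨ULift (Multiplicative (ZMod 3)), inferInstance, inferInstance, ?_⟩
  have hcyc : IsCyclic (ULift.{u} (Multiplicative (ZMod 3))) :=
    isCyclic_of_surjective MulEquiv.ulift.symm (MulEquiv.surjective _)
  have hInn : Inn (ULift.{u} (Multiplicative (ZMod 3))) = ⊥ := by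
    rw [eq_bot_iff]
    rintro _ ⟨g, rfl⟩
    rw [Subgroup.mem_bot]
    ext1 x
    rw [MulAut.conj_apply, mul_inv_cancel_comm]; rfl
  have hcard : Nat.card (Out (ULift.{u} (Multiplicative (ZMod 3)))) = 2 := by
    have h1 := Subgroup.card_eq_card_quotient_mul_card_subgroup
      (Inn (ULift.{u} (Multiplicative (ZMod 3))))
    rw [IsCyclic.card_mulAut, hInn, Subgroup.card_bot, mul_one] at h1
    rw [Out, hInn, ← h1]
    simp only [Nat.card_congr Equiv.ulift, Nat.card_congr Multiplicative.toAdd, Nat.card_zmod]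
    decide
  have : Fact (Nat.Prime 2) := ⟨Nat.prime_two⟩
  exact ⟨mulEquivOfPrimeCardEq hcard hG⟩

end FiniteOut

theorem theorem3p4 (G : Type u) [Group G] [Finite G] :
    (∀ (n p : ℕ) (e : Fin n ≃ G) (ζ : (ZMod p)ˣ), 3 ≤ n → p.Prime → n < p →
      (∀ z : (ZMod p)ˣ, z ∈ Subgroup.zpowers ζ) →
        (∀ i : G, ∃! q : MulAut (FiniteOut.GroupP p e), FiniteOut.IsDiagAut e ζ i q) ∧
        Nonempty (FiniteOut.groupQ e ζ ≃* (Fin n → Multiplicative (ZMod (p - 1)))) ∧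
        Finite (FiniteOut.GroupH e ζ) ∧
        Nonempty (FiniteOut.Out (FiniteOut.GroupH e ζ) ≃* G)) ∧
    ∃ (H : Type u) (_ : Group H), Finite H ∧ Nonempty (FiniteOut.Out H ≃* G) := by
  classical
  have main : ∀ (n p : ℕ) (e : Fin n ≃ G) (ζ : (ZMod p)ˣ), 3 ≤ n → p.Prime → n < p →
      (∀ z : (ZMod p)ˣ, z ∈ Subgroup.zpowers ζ) →
        (∀ i : G, ∃! q : MulAut (FiniteOut.GroupP p e), FiniteOut.IsDiagAut e ζ i q) ∧
        Nonempty (FiniteOut.groupQ e ζ ≃* (Fin n → Multiplicative (ZMod (p - 1)))) ∧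
        Finite (FiniteOut.GroupH e ζ) ∧
        Nonempty (FiniteOut.Out (FiniteOut.GroupH e ζ) ≃* G) := by
    intro n p e ζ hn hp hnp hζ
    have := Fact.mk hp
    have := FiniteOut.GroupP.finite e hp.pos
    refine ⟨fun i => ⟨_, FiniteOut.GroupP.isDiagAut_iff.2 rfl,
      fun q hq => FiniteOut.GroupP.isDiagAut_iff.1 hq⟩, ?_⟩
    delta FiniteOut.GroupH
    rw [FiniteOut.GroupP.groupQ_eq_range e hζ]
    exact ⟨FiniteOut.GroupP.nonempty_mulEquiv_pi (by omega),
      Finite.of_equiv _ SemidirectProduct.equivProd.symm,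
      ⟨(MulEquiv.ofBijective (FiniteOut.GroupP.outHom e)
        ⟨FiniteOut.GroupP.outHom_injective (by omega),
          FiniteOut.GroupP.outHom_surjective hn hnp⟩).symm⟩⟩
  refine ⟨main, ?_⟩
  have h0 : 0 < Nat.card G := Nat.card_pos
  obtain h1 | h2 | h3 : Nat.card G = 1 ∨ Nat.card G = 2 ∨ 3 ≤ Nat.card G := by omega
  · obtain ⟨hs, -⟩ := Nat.card_eq_one_iff_unique.1 h1
    have hu : Subsingleton (FiniteOut.Out PUnit.{u + 1}) :=
      Function.Surjective.subsingleton QuotientGroup.mk_surjective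
    have : Unique G := uniqueOfSubsingleton 1
    have : Unique (FiniteOut.Out PUnit.{u + 1}) := uniqueOfSubsingleton 1
    exact ⟨PUnit, inferInstance, inferInstance, ⟨MulEquiv.ofUnique⟩⟩
  · exact FiniteOut.nonempty_out_mulEquiv_of_card_eq_two h2
  · obtain ⟨p, hnp, hp⟩ := Nat.exists_infinite_primes (Nat.card G + 1)
    have := Fact.mk hp
    obtain ⟨ζ, hζ⟩ := IsCyclic.exists_generator (α := (ZMod p)ˣ)
    obtain ⟨-, -, hf, ho⟩ := main _ p (Finite.equivFin G).symm ζ h3 hp hnp hζ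
    exact ⟨_, _, hf, ho⟩
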